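/- All $L_1$ spaces have scalar field $\mathbb K\in\{\mathbb R,\mathbb C\}$; a function is non-negative if its values are non-negative reals almost everywhere, and a Schauder basis of a finite-dimensional space is a finite algebraic basis. Theorem. $L_1(0,\infty)$ has a Schauder basis consisting of non-negative functions. Consequently, for every measure space $(\Omega,\mu)$ such that $L_1(\mu)$ is separable, $L_1(\mu)$ has a Schauder basis consisting of non-negative functions. Moreover, such a basis of $L_1(0,\infty)$ is given by the following construction. For $j\ge1$, $n\ge0$ and $1\le i\le 2^n$ let $h^j_{n,i}$ be the $L_1$-normalized mean-zero Haar function on $(j-1,j)$ that equals $2^n$ on $\bigl(j-1+\frac{2i-2}{2^{n+1}},\,j-1+\frac{2i-1}{2^{n+1}}\bigr)$, equals $-2^n$ on $\bigl(j-1+\frac{2i-1}{2^{n+1}},\,j-1+\frac{2i}{2^{n+1}}\bigr)$, and is $0$ elsewhere. Let $(h_i)_{i\ge1}$ be an enumeration without repetition of all the $h^j_{n,k}$ that, for each fixed $j$, respects the lexicographic order of the pairs $(n,k)$. For a permutation $\pi$ of $\{1,2,\dots\}$ put $$g_i=2\,\mathbf 1_{(\pi(i)-1,\pi(i))}+|h_i|,\qquad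 F_i=\operatorname{span}\{g_i,h_i\},\qquad x_i=g_i+h_i,\qquad y_i=g_i-h_i .$$ (a) There is a constant $C$ such that for every such enumeration and every permutation $\pi$: each $F_i$ is two-dimensional; $(F_i)_{i\ge1}$ is a finite-dimensional decomposition of the closed linear span $Y$ of $\bigcup_iF_i$, i.e. every $v\in Y$ has a unique expansion $v=\sum_{i=1}^\infty v_i$ (norm convergence) with $v_i\in F_i$ for all $i$; for every $i$ the functions $x_i,y_i$ are non-negative and $(x_i,y_i)$ is a basis of $F_i$ with basis constant at most $C$; and $x_1,y_1,x_2,y_2,\dots$ is a Schauder basis of $Y$. (b) There is an enumeration as above with $h_1=h^1_{0,1}$. For every enumeration with $h_1=h^1_{0,1}$ there is a permutation $\pi$ with $\pi(1)=1$ and with $\pi(i)>j$ whenever $i>1$ and $h_i=h^j_{n,k}$ for some $n,k$. For every such permutation $Y=L_1(0,\infty)$; thus $(F_i)_{i\ge1}$ is a finite-dimensional decomposition of $L_1(0,\infty)$ and $x_1,y_1,x_2,y_2,\dots$ is a Schauder basis of $L_1(0,\infty)$ consisting of non-negative functions. -/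

import Mathlib

open MeasureTheory Set Filter Topology

noncomputable section

/-- A class in `L₁(μ)` is non-negative: almost everywhere its values are non-negative reals. -/
def NonnegL1 {𝕜 : Type*} [RCLike 𝕜] {α : Type*} [MeasurableSpace α] {μ : Measure α}
    (f : Lp 𝕜 1 μ) : Prop :=
  ∀ᵐ t ∂μ, ∃ r : ℝ, 0 ≤ r ∧ f t = (r : 𝕜)

/-- The space has a Schauder basis all of whose members are non-negative: either an infinite
Schauder basis, or (exactly when the space is finite dimensional) a finite basis. -/
def HasNonnegSchauderBasis (𝕜 : Type*) [RCLike 𝕜] {α : Type*} [MeasurableSpace α]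
    (μ : Measure α) : Prop :=
  (∃ b : SchauderBasis 𝕜 (Lp 𝕜 1 μ), ∀ i, NonnegL1 (b i)) ∨
  (∃ (n : ℕ) (b : Module.Basis (Fin n) 𝕜 (Lp 𝕜 1 μ)), ∀ i, NonnegL1 (b i))

/-- Lebesgue measure on `(0, ∞)`. -/
abbrev volPos : Measure ℝ := volume.restrict (Ioi (0 : ℝ))

/-- `L₁(0, ∞)` with scalars `𝕜`. -/
abbrev L1Pos (𝕜 : Type*) [RCLike 𝕜] := Lp 𝕜 1 volPos

/-- Indices of the mean zero Haar functions: `(j, ⟨n, i⟩)` is the `i`-th function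
(`0 ≤ i < 2 ^ n`) of level `n` on the interval `(j, j + 1)`. -/
abbrev HaarIndex : Type := ℕ × (Σ n : ℕ, Fin (2 ^ n))

/-- The strict lexicographic order on the pairs (level, position). -/
def HaarLex (a b : Σ n : ℕ, Fin (2 ^ n)) : Prop :=
  a.1 < b.1 ∨ (a.1 = b.1 ∧ (a.2 : ℕ) < (b.2 : ℕ))

/-- The `L₁`-normalized mean zero Haar function with index `(j, ⟨n, i⟩)`:
`2 ^ n` on the left half and `-2 ^ n` on the right half of
`(j + i / 2 ^ n, j + (i + 1) / 2 ^ n)`. -/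
def haarFun (k : HaarIndex) : ℝ → ℝ := fun t =>
  (Ioo ((k.1 : ℝ) + (2 * (k.2.2 : ℕ) : ℝ) / 2 ^ (k.2.1 + 1))
       ((k.1 : ℝ) + (2 * (k.2.2 : ℕ) + 1 : ℝ) / 2 ^ (k.2.1 + 1))).indicator
    (fun _ => (2 : ℝ) ^ k.2.1) t -
  (Ioo ((k.1 : ℝ) + (2 * (k.2.2 : ℕ) + 1 : ℝ) / 2 ^ (k.2.1 + 1))
       ((k.1 : ℝ) + (2 * (k.2.2 : ℕ) + 2 : ℝ) / 2 ^ (k.2.1 + 1))).indicator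
    (fun _ => (2 : ℝ) ^ k.2.1) t

/-- The function `2 · 1_{(m, m + 1)} + |h_k|`. -/
def bumpFun (m : ℕ) (k : HaarIndex) : ℝ → ℝ := fun t =>
  2 * (Ioo (m : ℝ) ((m : ℝ) + 1)).indicator (fun _ => (1 : ℝ)) t + |haarFun k t|

theorem memLp_indicator_Ioo (a b c : ℝ) :
    MemLp ((Ioo a b).indicator (fun _ => c)) 1 volPos := by
  refine memLp_indicator_const 1 measurableSet_Ioo c (Or.inr ?_)
  exact ((Measure.restrict_apply_le _ _).trans_lt (by simp)).ne

theorem memLp_haarFun (k : HaarIndex) : MemLp (haarFun k) 1 volPos :=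
  (memLp_indicator_Ioo _ _ _).sub (memLp_indicator_Ioo _ _ _)

theorem memLp_bumpFun (m : ℕ) (k : HaarIndex) : MemLp (bumpFun m k) 1 volPos :=
  ((memLp_indicator_Ioo _ _ _).const_mul 2).add (memLp_haarFun k).abs

/-- `haarFun k` as an element of `L₁(0, ∞)`. -/
def haarL1 (𝕜 : Type*) [RCLike 𝕜] (k : HaarIndex) : L1Pos 𝕜 :=
  (memLp_haarFun k).ofReal.toLp (fun t => ((haarFun k t : ℝ) : 𝕜))

/-- `bumpFun m k` as an element of `L₁(0, ∞)`. -/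
def bumpL1 (𝕜 : Type*) [RCLike 𝕜] (m : ℕ) (k : HaarIndex) : L1Pos 𝕜 :=
  (memLp_bumpFun m k).ofReal.toLp (fun t => ((bumpFun m k t : ℝ) : 𝕜))

/-- An enumeration of all mean zero Haar functions on all the intervals `(j, j + 1)` that
respects, for each `j`, the lexicographic order of those on `(j, j + 1)`. -/
def IsHaarEnum (e : ℕ ≃ HaarIndex) : Prop :=
  ∀ m n : ℕ, (e m).1 = (e n).1 → HaarLex (e m).2 (e n).2 → m < n

/-- The first function of the enumeration is the first Haar function on `(0, 1)`. -/
def StartsAtFirst (e : ℕ ≃ HaarIndex) : Prop :=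
  e 0 = (0, ⟨0, ⟨0, Nat.one_pos⟩⟩)

/-- `π` fixes the first index and sends every other `i` to an interval strictly to the right of
the one that carries the `i`-th Haar function. -/
def IsSuitablePerm (e : ℕ ≃ HaarIndex) (π : Equiv.Perm ℕ) : Prop :=
  π 0 = 0 ∧ ∀ i, 0 < i → (e i).1 < π i

section Blocks

variable (𝕜 : Type*) [RCLike 𝕜] (e : ℕ ≃ HaarIndex) (π : Equiv.Perm ℕ)

/-- The block `F_i`, spanned by `2 · 1_{(π i, π i + 1)} + |h_i|` and `h_i`. -/
def block (i : ℕ) : Submodule 𝕜 (L1Pos 𝕜) :=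
  Submodule.span 𝕜 {bumpL1 𝕜 (π i) (e i), haarL1 𝕜 (e i)}

/-- The closed linear span of all the blocks. -/
def blockSpan : Submodule 𝕜 (L1Pos 𝕜) := (⨆ i, block 𝕜 e π i).topologicalClosure

/-- `x_i = 2 · 1_{(π i, π i + 1)} + |h_i| + h_i`. -/
def blockX (i : ℕ) : L1Pos 𝕜 := bumpL1 𝕜 (π i) (e i) + haarL1 𝕜 (e i)

/-- `y_i = 2 · 1_{(π i, π i + 1)} + |h_i| - h_i`. -/
def blockY (i : ℕ) : L1Pos 𝕜 := bumpL1 𝕜 (π i) (e i) - haarL1 𝕜 (e i)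

/-- The sequence `x_0, y_0, x_1, y_1, …`. -/
def blockSeq (k : ℕ) : L1Pos 𝕜 :=
  if k % 2 = 0 then blockX 𝕜 e π (k / 2) else blockY 𝕜 e π (k / 2)

end Blocks

/-- The subspaces `F n` form a finite dimensional decomposition (FDD) of the closed
subspace `Y`: they are nonzero, finite dimensional, contained in `Y`, and each `v` in `Y` is in
a unique way the sum of a convergent series whose `n`-th term is in `F n`. -/
structure IsFDD {𝕜 : Type*} [RCLike 𝕜] {X : Type*} [NormedAddCommGroup X] [NormedSpace 𝕜 X]
    (F : ℕ → Submodule 𝕜 X) (Y : Submodule 𝕜 X) : Prop where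
  closed : IsClosed (Y : Set X)
  ne_bot : ∀ n, F n ≠ ⊥
  finiteDimensional : ∀ n, FiniteDimensional 𝕜 (F n)
  le : ∀ n, F n ≤ Y
  expansion : ∀ v ∈ Y, ∃! w : ℕ → X, (∀ n, w n ∈ F n) ∧
    Tendsto (fun N => ∑ n ∈ Finset.range N, w n) atTop (𝓝 v)

/-- `(x, y)` is a basis of `F` with basis constant at most `C`: the first basis projection
`a x + b y ↦ a x` has norm at most `C` (the last one is the identity). -/
structure IsTwoTermBasis {𝕜 : Type*} [RCLike 𝕜] {X : Type*} [NormedAddCommGroup X]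
    [NormedSpace 𝕜 X] (F : Submodule 𝕜 X) (x y : X) (C : ℝ) : Prop where
  linearIndependent : LinearIndependent 𝕜 ![x, y]
  span_eq : Submodule.span 𝕜 {x, y} = F
  one_le : 1 ≤ C
  norm_le : ∀ a b : 𝕜, ‖a • x‖ ≤ C * ‖a • x + b • y‖

end

/-! Write a finite sum as u = Σ (a_i g_i + b_i h_i). The functions h_i have mean zero on every unit
interval, so integrating u over the unit interval assigned to g_p leaves 2 a_p plus the sum of those
a_i whose Haar function lives on that interval. Each a_i occurs at most once in this second role,
because π is injective. Summing over p gives 2 Σ|a_p| ≤ ‖u‖ + Σ|a_i|, hence Σ|a_i| ≤ ‖u‖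
(`sum_norm_le_norm_sum`). The weight 2 against the normalization ‖h_i‖ = 1 is what makes this work.

So the bump part of u, and therefore its Haar part, is controlled by ‖u‖. The Haar functions in an
admissible order form a monotone basic sequence: each one has mean zero and is supported where all
its predecessors are constant (`norm_sum_haarL1_mono`). Together these bound the block projections
by 7, and all partial sums of x_0, y_0, x_1, y_1, … by 25 times any later one. The Grünblum
criterion turns this into a Schauder basis of the closed span, and pairing its terms gives the FDD.

For a suitable permutation the span is dense (`eq_top_of_bumpL1_mem`). The first bump is a multiple
of the indicator of (0,1), an indicator and its Haar function give both halves, and every other bump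
g_i yields a new unit interval from dyadic intervals further left.

A separable L₁(μ) is carried to L₁ of a finite measure on the line by coding points through
countably many generating sets (`exists_nonneg_equiv_real`). There the atoms span a copy of ℓ₁
(possibly finite dimensional), while a nonzero atomless part is isometric to L₁(0,∞) through
distribution functions, preserving non-negativity in both directions. The two bases are then merged.
-/

open scoped ENNReal NNReal

/-! ### Basic sequences, Schauder bases and decompositions. -/

section BasicSequences

variable {𝕜 : Type*} [RCLike 𝕜] {X : Type*} [NormedAddCommGroup X] [NormedSpace 𝕜 X]

/-- The coefficients have finite support, so all ranges past it give the same sum. This lets the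
partial sum inequality be applied to u at any sufficiently large length. -/
theorem mem_span_range_nat {v : ℕ → X} {u : X} (hu : u ∈ Submodule.span 𝕜 (range v)) :
    ∃ (c : ℕ → 𝕜) (m : ℕ), (∀ n, m ≤ n → u = ∑ i ∈ Finset.range n, c i • v i) := by
  obtain ⟨c, rfl⟩ := Finsupp.mem_span_range_iff_exists_finsupp.1 hu
  refine ⟨c, c.support.sup id + 1, fun n hn => ?_⟩
  refine Finsupp.sum_of_support_subset c (fun i hi => ?_) _ (by simp)
  have : i ≤ c.support.sup id := Finset.le_sup (f := id) hi
  simp; omega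

theorem tendsto_sum_range_of_hasSum {f : ℕ → X} {x : X}
    (h : HasSum f x (SummationFilter.conditional ℕ)) :
    Tendsto (fun N => ∑ n ∈ Finset.range N, f n) atTop (𝓝 x) := by
  rwa [HasSum, SummationFilter.conditional_filter_eq_map_range, tendsto_map'_iff] at h

theorem hasSum_conditional_of_tendsto {f : ℕ → X} {x : X}
    (h : Tendsto (fun N => ∑ n ∈ Finset.range N, f n) atTop (𝓝 x)) :
    HasSum f x (SummationFilter.conditional ℕ) := by
  rwa [HasSum, SummationFilter.conditional_filter_eq_map_range, tendsto_map'_iff]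

/-- A sequence whose partial sums are dominated by the later ones has biorthogonal functionals. -/
theorem exists_biorthogonal_of_norm_sum_le {v : ℕ → X} {K : ℝ} (hv : ∀ i, v i ≠ 0)
    (hK : ∀ (c : ℕ → 𝕜) (n m : ℕ), n ≤ m →
      ‖∑ i ∈ Finset.range n, c i • v i‖ ≤ K * ‖∑ i ∈ Finset.range m, c i • v i‖) :
    ∃ φ : ℕ → StrongDual 𝕜 X, ∀ i j, φ i (v j) = if i = j then 1 else 0 := by
  have hli : LinearIndependent 𝕜 v := by
    rw [linearIndependent_iff']
    intro s c hs i hi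
    set c' : ℕ → 𝕜 := fun k => if k ∈ s then c k else 0
    have h0 : ∑ k ∈ Finset.range (s.sup id + 1), c' k • v k = 0 := by
      rw [← hs]
      refine (Finset.sum_subset_zero_on_sdiff (fun k hk => ?_) (fun k hk => ?_)
        (fun k hk => ?_)).symm
      · have : k ≤ s.sup id := Finset.le_sup (f := id) hk
        simp; omega
      · have : k ∉ s := (Finset.mem_sdiff.1 hk).2
        simp [c', this]
      · simp [c', hk]
    have hle : i ≤ s.sup id := Finset.le_sup (f := id) hi
    -- All partial sums of a vanishing sum vanish, and two consecutive ones isolate the term `c' i •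
    -- v i`.
    have h1 := hK c' i _ (by omega : i ≤ s.sup id + 1)
    have h2 := hK c' (i + 1) _ (by omega : i + 1 ≤ s.sup id + 1)
    rw [h0, norm_zero, mul_zero, norm_le_zero_iff] at h1 h2
    rw [Finset.sum_range_succ, h1, zero_add, smul_eq_zero] at h2
    simpa [c', hi] using h2.resolve_right (hv i)
  have key : ∀ i, ∃ f : StrongDual 𝕜 X, ∀ j, f (v j) = if i = j then 1 else 0 := by
    intro i
    let g : Submodule.span 𝕜 (range v) →ₗ[𝕜] 𝕜 := (Finsupp.lapply i).comp hli.repr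
    have hg : ∀ j (h : v j ∈ Submodule.span 𝕜 (range v)), g ⟨v j, h⟩ = if i = j then 1 else 0 := by
      intro j h
      simp only [g, LinearMap.comp_apply, Finsupp.lapply_apply]
      rw [hli.repr_eq_single j _ rfl, Finsupp.single_apply]
      simp [eq_comm]
    -- A term is the difference of two consecutive partial sums, each at most K‖u‖, so the
    -- coordinate is bounded by 2K/‖v i‖ and Hahn–Banach extends it.
    have hbound : ∀ u, ‖g u‖ ≤ (2 * K / ‖v i‖) * ‖u‖ := by
      rintro ⟨u, hu⟩
      obtain ⟨c, m, hc⟩ := mem_span_range_nat hu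
      have hgc : g ⟨u, hu⟩ = c i := by
        have e : (⟨u, hu⟩ : Submodule.span 𝕜 (range v)) = ∑ k ∈ Finset.range (max m (i + 1)),
            c k • (⟨v k, Submodule.subset_span (mem_range_self k)⟩ :
              Submodule.span 𝕜 (range v)) := by
          ext
          simpa using hc _ (le_max_left _ _)
        rw [e, map_sum]
        simp only [map_smul, hg, smul_eq_mul, mul_ite, mul_one, mul_zero, Finset.sum_ite_eq,
          Finset.mem_range, lt_max_iff, Nat.lt_add_one, or_true, if_true]
      have h1 := hK c i _ (le_trans (Nat.le_succ i) (le_max_right m (i + 1)))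
      have h2 := hK c (i + 1) _ (le_max_right m (i + 1))
      rw [← hc _ (le_max_left _ _)] at h1 h2
      have h3 : ‖c i‖ * ‖v i‖ ≤ 2 * K * ‖u‖ := by
        rw [← norm_smul]
        have : c i • v i = ∑ k ∈ Finset.range (i + 1), c k • v k
            - ∑ k ∈ Finset.range i, c k • v k := by rw [Finset.sum_range_succ]; abel
        rw [this]
        refine (norm_sub_le _ _).trans ?_
        linarith
      rw [hgc, div_mul_eq_mul_div, le_div_iff₀ (norm_pos_iff.2 (hv i))]
      exact h3
    obtain ⟨f, hf, -⟩ := exists_extension_norm_eq _ (g.mkContinuous _ hbound)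
    refine ⟨f, fun j => ?_⟩
    have := hf ⟨v j, Submodule.subset_span (mem_range_self j)⟩
    rw [this]
    exact hg j _
  choose φ hφ using key
  exact ⟨φ, hφ⟩

/-- The Grünblum criterion: a sequence of nonzero vectors whose partial sums are uniformly
dominated by the later ones is a Schauder basis of its closed linear span. -/
theorem exists_schauderBasis_of_norm_sum_le {v : ℕ → X} {K : ℝ} (hv : ∀ i, v i ≠ 0)
    (hK : ∀ (c : ℕ → 𝕜) (n m : ℕ), n ≤ m →
      ‖∑ i ∈ Finset.range n, c i • v i‖ ≤ K * ‖∑ i ∈ Finset.range m, c i • v i‖)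
    {Y : Submodule 𝕜 X} (hY : Y = (Submodule.span 𝕜 (range v)).topologicalClosure) :
    ∃ b : SchauderBasis 𝕜 Y, ∀ k, (b k : X) = v k := by
  obtain ⟨φ, hφ⟩ := exists_biorthogonal_of_norm_sum_le hv hK
  have hvY : ∀ i, v i ∈ Y := fun i => by
    rw [hY]
    exact Submodule.le_topologicalClosure _ (Submodule.subset_span (mem_range_self i))
  let P : ℕ → X →L[𝕜] X := fun n => ∑ i ∈ Finset.range n, (φ i).smulRight (v i)
  have hP : ∀ n x, P n x = ∑ i ∈ Finset.range n, φ i x • v i := fun n x => by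
    simp [P]
  have hPu : ∀ u ∈ Submodule.span 𝕜 (range v), ∃ m, (∀ n, m ≤ n → P n u = u) ∧
      ∀ n, ‖P n u‖ ≤ K * ‖u‖ := by
    intro u hu
    obtain ⟨c, m, hc⟩ := mem_span_range_nat hu
    have hcoord : ∀ i, φ i u = c i := by
      intro i
      rw [hc (max m (i + 1)) (le_max_left _ _), map_sum]
      simp [hφ]
    refine ⟨m, fun n hn => ?_, fun n => ?_⟩
    · rw [hP, hc n hn]
      refine Finset.sum_congr rfl fun i _ => ?_
      rw [← hc n hn, hcoord]
    · rw [hP]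
      simp_rw [hcoord]
      have := hK c n (max m n) (le_max_right _ _)
      rwa [← hc _ (le_max_left _ _)] at this
  have hbd : ∀ y ∈ Y, ∀ n, ‖P n y‖ ≤ K * ‖y‖ := by
    intro y hy n
    rw [hY] at hy
    exact closure_minimal (s := (Submodule.span 𝕜 (range v) : Set X))
      (t := {y | ‖P n y‖ ≤ K * ‖y‖}) (fun u hu => (hPu u hu).choose_spec.2 n)
      (isClosed_le (by fun_prop) (by fun_prop)) hy
  have hlim : ∀ y ∈ Y, Tendsto (fun n => P n y) atTop (𝓝 y) := by
    intro y hy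
    rw [Metric.tendsto_atTop]
    intro ε hε
    have hy' := hy
    rw [hY] at hy'
    have hδ : 0 < ε / (|K| + 2) := by positivity
    obtain ⟨u, hu, hyu⟩ := Metric.mem_closure_iff.1 hy' _ hδ
    obtain ⟨m, hm, -⟩ := hPu u hu
    refine ⟨m, fun n hn => ?_⟩
    have hyuY : y - u ∈ Y := Y.sub_mem hy (by
      rw [hY]; exact Submodule.le_topologicalClosure _ hu)
    have h1 := hbd _ hyuY n
    rw [dist_eq_norm] at hyu ⊢
    -- `P n` fixes u, so the error is (P n − 1)(y − u), of norm at most (|K| + 1)‖y − u‖.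
    have e : P n y - y = P n (y - u) - (y - u) := by rw [map_sub, hm n hn]; abel
    rw [e]
    have h2 : K * ‖y - u‖ ≤ |K| * ‖y - u‖ :=
      mul_le_mul_of_nonneg_right (le_abs_self K) (norm_nonneg _)
    have h3 := norm_sub_le (P n (y - u)) (y - u)
    rw [lt_div_iff₀ (by positivity)] at hyu
    have h4 := norm_nonneg (y - u)
    nlinarith [abs_nonneg K]
  refine ⟨⟨fun k => ⟨v k, hvY k⟩, fun k => (φ k).comp Y.subtypeL, fun i j => ?_, fun y => ?_⟩,
    fun k => rfl⟩
  · simp [hφ, Pi.single_apply]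
  · refine hasSum_conditional_of_tendsto ?_
    rw [tendsto_subtype_rng]
    refine (hlim y y.2).congr fun n => ?_
    simp [hP]

/-- The image of a Schauder basis under a continuous linear equivalence. -/
noncomputable def mapSchauderBasis {X' : Type*} [NormedAddCommGroup X'] [NormedSpace 𝕜 X']
    (b : SchauderBasis 𝕜 X) (T : X ≃L[𝕜] X') : SchauderBasis 𝕜 X' where
  basis i := T (b i)
  coord i := (b.coord i).comp (T.symm : X' →L[𝕜] X)
  ortho i j := by simpa using b.ortho i j
  expansion x := by
    have h := tendsto_sum_range_of_hasSum (b.expansion (T.symm x))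
    refine hasSum_conditional_of_tendsto ?_
    have := ((T : X →L[𝕜] X').continuous.tendsto _).comp h
    simpa [Function.comp_def] using this

theorem schauderBasis_coord_self (b : SchauderBasis 𝕜 X) (i j : ℕ) :
    b.coord i (b j) = if i = j then 1 else 0 := by
  rw [b.ortho]
  by_cases h : i = j
  · subst h; simp
  · simp [h]

/-- Grouping the terms of a Schauder basis into consecutive pairs gives an FDD. -/
theorem isFDD_of_schauderBasis {v : ℕ → X} {Y : Submodule 𝕜 X} (hYc : IsClosed (Y : Set X))
    (b : SchauderBasis 𝕜 Y) (hb : ∀ k, (b k : X) = v k) {F : ℕ → Submodule 𝕜 X}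
    (hF : ∀ n, F n = Submodule.span 𝕜 {v (2 * n), v (2 * n + 1)}) : IsFDD F Y := by
  have hvY : ∀ k, v k ∈ Y := fun k => by rw [← hb]; exact (b k).2
  have hle : ∀ n, F n ≤ Y := fun n => by
    rw [hF, Submodule.span_le]
    rintro x (rfl | rfl) <;> exact hvY _
  have hv0 : ∀ k, v k ≠ 0 := fun k => by
    rw [← hb]
    simpa using b.linearIndependent.ne_zero k
  refine ⟨hYc, fun n h => ?_, fun n => ?_, hle, fun x hx => ?_⟩
  · have : v (2 * n) ∈ F n := by rw [hF]; exact Submodule.subset_span (by simp)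
    rw [h] at this
    exact hv0 _ (by simpa using this)
  · rw [hF]
    exact FiniteDimensional.span_of_finite 𝕜 (by simp)
  · have hcoord : ∀ k n (y : Y), (y : X) ∈ F n → k / 2 ≠ n → b.coord k y = 0 := by
      intro k n y hy hkn
      rw [hF] at hy
      obtain ⟨p, q, hpq⟩ := Submodule.mem_span_pair.1 hy
      have e : y = p • b (2 * n) + q • b (2 * n + 1) := by
        ext; simp [hb, ← hpq]
      rw [e, map_add, map_smul, map_smul, schauderBasis_coord_self,
        schauderBasis_coord_self, if_neg (by omega), if_neg (by omega)]
      simp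
    refine ⟨fun n => b.coord (2 * n) ⟨x, hx⟩ • v (2 * n)
      + b.coord (2 * n + 1) ⟨x, hx⟩ • v (2 * n + 1), ⟨fun n => ?_, ?_⟩, ?_⟩
    · rw [hF]
      exact Submodule.mem_span_pair.2 ⟨_, _, rfl⟩
    · have h := tendsto_sum_range_of_hasSum (b.expansion ⟨x, hx⟩)
      rw [tendsto_subtype_rng] at h
      have h2 : Tendsto (fun N : ℕ => 2 * N) atTop atTop :=
        tendsto_id.const_mul_atTop' (by norm_num)
      refine (h.comp h2).congr fun N => ?_
      simp only [Function.comp, Submodule.coe_sum, Submodule.coe_smul, hb]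
      induction N with
      | zero => simp
      | succ N ih =>
        rw [show 2 * (N + 1) = 2 * N + 1 + 1 by ring, Finset.sum_range_succ,
          Finset.sum_range_succ, ih, Finset.sum_range_succ, add_assoc]
    · rintro w ⟨hwF, hw⟩
      let w' : ℕ → Y := fun n => ⟨w n, hle n (hwF n)⟩
      have hw' : Tendsto (fun N => ∑ n ∈ Finset.range N, w' n) atTop (𝓝 (⟨x, hx⟩ : Y)) := by
        rw [tendsto_subtype_rng]
        simpa [w'] using hw
      -- Uniqueness: coordinate k of the partial sums stops changing once the block k / 2 is
      -- included, and its limit is the coordinate of x.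
      have hk : ∀ k, b.coord k (w' (k / 2)) = b.coord k ⟨x, hx⟩ := by
        intro k
        refine tendsto_nhds_unique ?_ (((b.coord k).continuous.tendsto _).comp hw')
        refine tendsto_const_nhds.congr' ?_
        filter_upwards [eventually_gt_atTop (k / 2)] with N hN
        rw [Function.comp, map_sum, Finset.sum_eq_single (k / 2)]
        · intro n _ hn
          exact hcoord k n _ (hwF n) (Ne.symm hn)
        · intro h; exact absurd (Finset.mem_range.2 hN) h
      funext n
      have hn := hwF n
      rw [hF] at hn
      obtain ⟨p, q, hpq⟩ := Submodule.mem_span_pair.1 hn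
      have e : w' n = p • b (2 * n) + q • b (2 * n + 1) := by
        ext; simp [hb, hpq, w']
      have h1 := hk (2 * n)
      have h2 := hk (2 * n + 1)
      rw [show 2 * n / 2 = n by omega, e] at h1
      rw [show (2 * n + 1) / 2 = n by omega, e] at h2
      simp only [map_add, map_smul, schauderBasis_coord_self] at h1 h2
      simp at h1 h2
      rw [← h1, ← h2, hpq]

theorem finset_eq_range_card_of_lower {s : Finset ℕ} (h : ∀ i ∈ s, ∀ j < i, j ∈ s) :
    s = Finset.range s.card := by
  refine Finset.eq_of_subset_of_card_le (fun x hx => ?_) (by simp)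
  have : Finset.range (x + 1) ⊆ s := fun j hj => by
    rcases (Nat.lt_succ_iff.1 (Finset.mem_range.1 hj)).eq_or_lt with rfl | h'
    · exact hx
    · exact h x hx j h'
  simpa using Finset.card_le_card this

/-- Only the Schauder basis has to keep its order in the merged sequence; the unconditional part may
be inserted anywhere. A finite A goes first, an infinite one is interleaved. -/
theorem exists_sum_equiv_nat (A : Type*) [Countable A] :
    ∃ σ : ℕ ⊕ A ≃ ℕ, StrictMono fun i => σ (Sum.inl i) := by
  rcases finite_or_infinite A with hA | hA
  · obtain ⟨n, ⟨f⟩⟩ := Finite.exists_equiv_fin A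
    refine ⟨(Equiv.sumComm _ _).trans ((Equiv.sumCongr f (Equiv.refl ℕ)).trans
      (finSumNatEquiv n)), fun i j hij => ?_⟩
    simpa using hij
  · obtain ⟨f⟩ := nonempty_equiv_of_countable (α := A) (β := ℕ)
    refine ⟨(Equiv.sumCongr (Equiv.refl ℕ) f).trans Equiv.natSumNatEquivNat, fun i j hij => ?_⟩
    simpa using hij

/-- If `X` splits as a copy of a space with a Schauder basis and a part with a countable
unconditional basis, then these two bases can be merged. -/
theorem exists_schauderBasis_of_split {X' : Type*} [NormedAddCommGroup X'] [NormedSpace 𝕜 X']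
    (b : SchauderBasis 𝕜 X') (ι : X' →L[𝕜] X) (R : X →L[𝕜] X') (hRι : ∀ x, R (ι x) = x)
    {A : Type*} [Countable A] [DecidableEq A] (e : A → X) (δ : A → StrongDual 𝕜 X)
    (hδe : ∀ a a', δ a (e a') = if a = a' then 1 else 0) (hδι : ∀ a x, δ a (ι x) = 0)
    (hRe : ∀ a, R (e a) = 0) (hsum : ∀ x, HasSum (fun a => δ a x • e a) (x - ι (R x))) :
    ∃ B : SchauderBasis 𝕜 X, ∀ k, (∃ i, B k = ι (b i)) ∨ ∃ a, B k = e a := by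
  obtain ⟨σ, hσ⟩ := exists_sum_equiv_nat A
  let bas : ℕ ⊕ A → X := Sum.elim (fun i => ι (b i)) e
  let co : ℕ ⊕ A → StrongDual 𝕜 X := Sum.elim (fun i => (b.coord i).comp R) δ
  have hort : ∀ s t, co s (bas t) = if s = t then 1 else 0 := by
    rintro (i | a) (j | a') <;> simp [co, bas, hRι, hδe, hδι, hRe, schauderBasis_coord_self]
  refine ⟨⟨fun k => bas (σ.symm k), fun k => co (σ.symm k), fun i j => ?_, fun x => ?_⟩,
    fun k => ?_⟩
  · rw [hort]
    by_cases h : i = j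
    · subst h; simp
    · simp [h]
  · refine hasSum_conditional_of_tendsto ?_
    let T : ℕ → Finset (ℕ ⊕ A) := fun N => (Finset.range N).map σ.symm.toEmbedding
    have hT : ∀ N s, s ∈ T N ↔ σ s < N := fun N s => by simp [T]
    -- Since σ is increasing on the left summand, the left indices met so far form an initial
    -- segment, so they contribute a genuine partial sum of the expansion of `R x`.
    have hsplit : ∀ N, ∑ k ∈ Finset.range N, co (σ.symm k) x • bas (σ.symm k)
        = ι (∑ i ∈ Finset.range (T N).toLeft.card, b.coord i (R x) • b i)
          + ∑ a ∈ (T N).toRight, δ a x • e a := by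
      intro N
      have h1 : ∑ k ∈ Finset.range N, co (σ.symm k) x • bas (σ.symm k)
          = ∑ s ∈ T N, co s x • bas s := by simp [T]
      have hlow : (T N).toLeft = Finset.range (T N).toLeft.card := by
        refine finset_eq_range_card_of_lower fun i hi j hj => ?_
        rw [Finset.mem_toLeft, hT] at hi ⊢
        exact (hσ hj).trans hi
      rw [h1, ← hlow, ← Finset.toLeft_disjSum_toRight (u := T N), Finset.sum_disjSum]
      simp [co, bas]
    have hp : Tendsto (fun N => (T N).toLeft.card) atTop atTop := by
      refine tendsto_atTop.2 fun k => ?_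
      filter_upwards [eventually_gt_atTop (σ (Sum.inl k))] with N hN
      have : Finset.range k ⊆ (T N).toLeft := fun i hi => by
        rw [Finset.mem_toLeft, hT]
        exact (hσ (Finset.mem_range.1 hi)).trans hN
      simpa using Finset.card_le_card this
    have hq : Tendsto (fun N => (T N).toRight) atTop atTop := by
      refine tendsto_atTop_finset_of_monotone (fun N M h a ha => ?_) fun a => ?_
      · rw [Finset.mem_toRight, hT] at ha ⊢
        omega
      · exact ⟨σ (Sum.inr a) + 1, by rw [Finset.mem_toRight, hT]; omega⟩
    have h1 := (ι.continuous.tendsto _).comp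
      ((tendsto_sum_range_of_hasSum (b.expansion (R x))).comp hp)
    have h2 := Tendsto.comp (show Tendsto _ _ _ from hsum x) hq
    have h3 := h1.add h2
    rw [add_sub_cancel] at h3
    exact h3.congr fun N => (hsplit N).symm
  · change (∃ i, bas (σ.symm k) = _) ∨ ∃ a, bas (σ.symm k) = _
    rcases σ.symm k with i | a
    · exact Or.inl ⟨i, rfl⟩
    · exact Or.inr ⟨a, rfl⟩

/-- A countable unconditional basis can be enumerated to a Schauder basis or is a finite basis. -/
theorem exists_basis_of_hasSum {A : Type*} [Countable A] [DecidableEq A] (e : A → X)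
    (δ : A → StrongDual 𝕜 X) (hδe : ∀ a a', δ a (e a') = if a = a' then 1 else 0)
    (hsum : ∀ x, HasSum (fun a => δ a x • e a) x) :
    (∃ B : SchauderBasis 𝕜 X, ∀ k, ∃ a, B k = e a) ∨
      ∃ (n : ℕ) (B : Module.Basis (Fin n) 𝕜 X), ∀ k, ∃ a, B k = e a := by
  rcases finite_or_infinite A with hA | hA
  · right
    obtain ⟨n, ⟨f⟩⟩ := Finite.exists_equiv_fin A
    have : Fintype A := Fintype.ofFinite A
    have hli : LinearIndependent 𝕜 e := by
      rw [Fintype.linearIndependent_iff]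
      intro g hg a
      simpa [hδe] using congrArg (δ a) hg
    have hsp : ⊤ ≤ Submodule.span 𝕜 (range e) := fun x _ => by
      rw [← (hsum x).tsum_eq, tsum_fintype]
      exact Submodule.sum_mem _ fun a _ =>
        Submodule.smul_mem _ _ (Submodule.subset_span (mem_range_self a))
    exact ⟨n, (Module.Basis.mk hli hsp).reindex f, fun k => ⟨f.symm k, by simp⟩⟩
  · left
    obtain ⟨f⟩ := nonempty_equiv_of_countable (α := ℕ) (β := A)
    refine ⟨⟨fun k => e (f k), fun k => δ (f k), fun i j => ?_, fun x => ?_⟩, fun k => ⟨f k, rfl⟩⟩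
    · rw [hδe]
      by_cases h : i = j
      · subst h; simp
      · simp [h]
    · exact hasSum_conditional_of_tendsto
        ((f.hasSum_iff (f := fun a => δ a x • e a)).2 (hsum x)).tendsto_sum_nat

end BasicSequences

/-! ### Closed subspaces of L₁ and the indicators they contain. -/

section Indicators

variable {𝕜 : Type*} [RCLike 𝕜] {α : Type*} [MeasurableSpace α] {μ : Measure α}

/-- The subspace `Z` of `L₁(μ)` contains the indicator of the set `S` of finite measure. -/
def ContainsIndicator (Z : Submodule 𝕜 (Lp 𝕜 1 μ)) (S : Set α) : Prop :=
  ∃ (hS : MeasurableSet S) (hμ : μ S ≠ ∞), indicatorConstLp 1 hS hμ (1 : 𝕜) ∈ Z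

namespace ContainsIndicator

variable {Z : Submodule 𝕜 (Lp 𝕜 1 μ)} {S T : Set α}

theorem of_mem {f : Lp 𝕜 1 μ} (hf : f ∈ Z) (hS : MeasurableSet S) (hμ : μ S ≠ ∞)
    (h : f =ᵐ[μ] S.indicator fun _ => (1 : 𝕜)) : ContainsIndicator Z S := by
  refine ⟨hS, hμ, ?_⟩
  have : indicatorConstLp 1 hS hμ (1 : 𝕜) = f := Lp.ext (indicatorConstLp_coeFn.trans h.symm)
  rwa [this]

theorem empty : ContainsIndicator Z ∅ :=
  ⟨MeasurableSet.empty, by simp, by rw [indicatorConstLp_empty]; exact Z.zero_mem⟩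

theorem congr_ae (h : ContainsIndicator Z S) (hT : MeasurableSet T) (hST : S =ᵐ[μ] T) :
    ContainsIndicator Z T := by
  obtain ⟨hS, hμ, hZ⟩ := h
  exact of_mem hZ hT (by rwa [← measure_congr hST])
    (indicatorConstLp_coeFn.trans (indicator_ae_eq_of_ae_eq_set hST))

theorem union (hS : ContainsIndicator Z S) (hT : ContainsIndicator Z T) (hd : Disjoint S T) :
    ContainsIndicator Z (S ∪ T) := by
  obtain ⟨h1, h2, h3⟩ := hS
  obtain ⟨k1, k2, k3⟩ := hT
  refine ⟨h1.union k1, measure_union_ne_top h2 k2, ?_⟩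
  rw [indicatorConstLp_disjoint_union h1 k1 h2 k2 hd]
  exact Z.add_mem h3 k3

theorem diff (hS : ContainsIndicator Z S) (hT : ContainsIndicator Z T) (hST : S ⊆ T) :
    ContainsIndicator Z (T \ S) := by
  obtain ⟨h1, h2, h3⟩ := hS
  obtain ⟨k1, k2, k3⟩ := hT
  have h4 : μ (T \ S) ≠ ∞ := measure_ne_top_of_subset sdiff_subset k2
  refine ⟨k1.diff h1, h4, ?_⟩
  have := indicatorConstLp_disjoint_union (p := 1) h1 (k1.diff h1) h2 h4 disjoint_sdiff_right
    (1 : 𝕜)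
  simp only [union_sdiff_cancel hST] at this
  rw [← sub_eq_iff_eq_add'] at this
  rw [← this]
  exact Z.sub_mem k3 h3

theorem of_tendsto (hZ : IsClosed (Z : Set (Lp 𝕜 1 μ))) {t : ℕ → Set α}
    (ht : ∀ n, ContainsIndicator Z (t n)) (hS : MeasurableSet S) (hμ : μ S ≠ ∞)
    (h : Tendsto (fun n => μ (symmDiff (t n) S)) atTop (𝓝 0)) : ContainsIndicator Z S := by
  choose h1 h2 h3 using ht
  exact ⟨hS, hμ, hZ.mem_of_tendsto
    (tendsto_indicatorConstLp_set (ht := h1) (hμt := h2) (c := (1 : 𝕜)) ENNReal.one_ne_top h)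
    (Eventually.of_forall h3)⟩

theorem iUnion_of_monotone (hZ : IsClosed (Z : Set (Lp 𝕜 1 μ))) {t : ℕ → Set α}
    (ht : ∀ n, ContainsIndicator Z (t n)) (hm : Monotone t) (hμ : μ (⋃ n, t n) ≠ ∞) :
    ContainsIndicator Z (⋃ n, t n) := by
  have hmeas : MeasurableSet (⋃ n, t n) := MeasurableSet.iUnion fun n => (ht n).1
  refine of_tendsto hZ ht hmeas hμ ?_
  have h1 : ∀ n, symmDiff (t n) (⋃ n, t n) = (⋃ n, t n) \ t n := fun n =>
    symmDiff_of_le (subset_iUnion t n)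
  simp_rw [h1]
  have h2 := tendsto_measure_iInter_atTop (μ := μ) (s := fun n => (⋃ n, t n) \ t n)
    (fun n => (hmeas.diff (ht n).1).nullMeasurableSet)
    (fun n m hnm => sdiff_subset_sdiff_right (hm hnm))
    ⟨0, measure_ne_top_of_subset sdiff_subset hμ⟩
  have h3 : (⋂ n, (⋃ n, t n) \ t n) = ∅ := by
    rw [← sdiff_iUnion, sdiff_self]
  rwa [h3, measure_empty] at h2

theorem iUnion_of_disjoint (hZ : IsClosed (Z : Set (Lp 𝕜 1 μ))) {t : ℕ → Set α}
    (ht : ∀ n, ContainsIndicator Z (t n)) (hd : Pairwise (Function.onFun Disjoint t))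
    (hμ : μ (⋃ n, t n) ≠ ∞) : ContainsIndicator Z (⋃ n, t n) := by
  rw [← iUnion_accumulate] at hμ ⊢
  refine iUnion_of_monotone hZ (fun n => ?_) monotone_accumulate hμ
  induction n with
  | zero => simpa using ht 0
  | succ n ih =>
    rw [accumulate_succ]
    exact ih.union (ht _) (disjoint_accumulate hd (Nat.lt_succ_self n))

/-- The sets S whose trace on A has its indicator in Z form a Dynkin system. Cutting with A of
finite measure keeps complements and countable disjoint unions inside L₁. -/
theorem inter_of_piSystem (hZ : IsClosed (Z : Set (Lp 𝕜 1 μ))) {C : Set (Set α)}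
    (hC : ‹MeasurableSpace α› = MeasurableSpace.generateFrom C) (hpi : IsPiSystem C) {A : Set α}
    (hA : ContainsIndicator Z A) (h : ∀ S ∈ C, ContainsIndicator Z (S ∩ A)) {S : Set α}
    (hS : MeasurableSet S) : ContainsIndicator Z (S ∩ A) := by
  induction S, hS using MeasurableSpace.induction_on_inter hC hpi with
  | empty => simpa using empty
  | basic t ht => exact h t ht
  | compl t ht ih =>
    have : tᶜ ∩ A = A \ (t ∩ A) := by ext x; simp; tauto
    rw [this]
    exact ih.diff hA inter_subset_right
  | iUnion f hd hf ih =>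
    rw [iUnion_inter]
    exact iUnion_of_disjoint hZ ih
      (fun i j hij => (hd hij).mono inter_subset_left inter_subset_left)
      (measure_ne_top_of_subset (iUnion_subset fun i => inter_subset_right) hA.2.1)

end ContainsIndicator

/-- A closed subspace that contains all indicators is everything. -/
theorem eq_top_of_containsIndicator {Z : Submodule 𝕜 (Lp 𝕜 1 μ)}
    (hZ : IsClosed (Z : Set (Lp 𝕜 1 μ)))
    (h : ∀ S, MeasurableSet S → μ S ≠ ∞ → ContainsIndicator Z S) : Z = ⊤ := by
  refine eq_top_iff.2 fun f _ => ?_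
  refine Lp.induction ENNReal.one_ne_top (fun f => f ∈ Z) (fun c S hS hμ => ?_)
    (fun f g _ _ _ => Z.add_mem) hZ f
  obtain ⟨h1, h2, h3⟩ := h S hS hμ.ne
  rw [Lp.simpleFunc.coe_indicatorConst]
  have e : indicatorConstLp 1 hS hμ.ne c = c • indicatorConstLp 1 h1 h2 (1 : 𝕜) := by
    refine Lp.ext (indicatorConstLp_coeFn.trans ?_)
    filter_upwards [Lp.coeFn_smul c (indicatorConstLp 1 h1 h2 (1 : 𝕜)),
      indicatorConstLp_coeFn (p := 1) (hs := h1) (hμs := h2) (c := (1 : 𝕜))] with x hx hx'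
    rw [hx, Pi.smul_apply, hx']
    by_cases hxS : x ∈ S <;> simp [hxS]
  rw [e]
  exact Z.smul_mem c h3

/-- Half-lines may have infinite measure, so the π-λ argument runs inside each `A n` and monotone
convergence removes the cut. -/
theorem eq_top_of_containsIndicator_Iic {μ : Measure ℝ} {Z : Submodule 𝕜 (Lp 𝕜 1 μ)}
    (hZ : IsClosed (Z : Set (Lp 𝕜 1 μ))) {A : ℕ → Set ℝ} (hA : Monotone A)
    (hAμ : μ (⋃ n, A n)ᶜ = 0) (hAZ : ∀ n, ContainsIndicator Z (A n))
    (h : ∀ n x, ContainsIndicator Z (Iic x ∩ A n)) : Z = ⊤ := by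
  refine eq_top_of_containsIndicator hZ fun S hS hμ => ?_
  have h1 : ∀ n, ContainsIndicator Z (S ∩ A n) := fun n =>
    ContainsIndicator.inter_of_piSystem hZ
      ((BorelSpace.measurable_eq (α := ℝ)).trans (borel_eq_generateFrom_Iic ℝ)) isPiSystem_Iic
      (hAZ n) (by rintro _ ⟨x, rfl⟩; exact h n x) hS
  have h2 : ContainsIndicator Z (⋃ n, S ∩ A n) :=
    ContainsIndicator.iUnion_of_monotone hZ h1
      (fun n m hnm => inter_subset_inter_right _ (hA hnm))
      (measure_ne_top_of_subset (iUnion_subset fun n => inter_subset_left) hμ)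
  refine h2.congr_ae hS ?_
  rw [← inter_iUnion]
  refine inter_ae_eq_left_of_ae_eq_univ ?_
  rwa [ae_eq_univ]

end Indicators

/-! ### Weighted composition operators between L₁ spaces. -/

section WeightedComposition

variable {𝕜 : Type*} [RCLike 𝕜] {α β : Type*} [MeasurableSpace α] [MeasurableSpace β]
  {μ : Measure α} {ν : Measure β} {φ : α → β} {w : α → ℝ≥0}

theorem ae_comp_of_map_withDensity (hφ : Measurable φ) (hw : Measurable w)
    (hν : ν = (μ.withDensity fun x => (w x : ℝ≥0∞)).map φ) {p : β → Prop} (hp : ∀ᵐ y ∂ν, p y) :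
    ∀ᵐ x ∂μ, w x ≠ 0 → p (φ x) := by
  rw [hν] at hp
  have := (ae_withDensity_iff hw.coe_nnreal_ennreal).1 (ae_of_ae_map hφ.aemeasurable hp)
  simpa using this

theorem integrable_smul_comp_iff (hφ : Measurable φ) (hw : Measurable w)
    (hν : ν = (μ.withDensity fun x => (w x : ℝ≥0∞)).map φ) {f : β → 𝕜}
    (hf : AEStronglyMeasurable f ν) :
    Integrable (fun x => w x • f (φ x)) μ ↔ Integrable f ν := by
  subst hν
  rw [integrable_map_measure hf hφ.aemeasurable, integrable_withDensity_iff_integrable_smul hw]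
  rfl

theorem smul_comp_ae_congr (hφ : Measurable φ) (hw : Measurable w)
    (hν : ν = (μ.withDensity fun x => (w x : ℝ≥0∞)).map φ) {f g : β → 𝕜} (h : f =ᵐ[ν] g) :
    (fun x => w x • f (φ x)) =ᵐ[μ] fun x => w x • g (φ x) := by
  filter_upwards [ae_comp_of_map_withDensity hφ hw hν h] with x hx
  by_cases h0 : w x = 0
  · simp [h0]
  · rw [hx h0]

/-- If `ν` is the image under `φ` of the measure with density `w` with respect to `μ`, then
`f ↦ w • (f ∘ φ)` is an isometric embedding of `L₁(ν)` into `L₁(μ)`. -/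
noncomputable def weightedComp (𝕜 : Type*) [RCLike 𝕜] (hφ : Measurable φ) (hw : Measurable w)
    (hν : ν = (μ.withDensity fun x => (w x : ℝ≥0∞)).map φ) : Lp 𝕜 1 ν →ₗᵢ[𝕜] Lp 𝕜 1 μ where
  toFun f := ((integrable_smul_comp_iff hφ hw hν (Lp.aestronglyMeasurable f)).2
    (L1.integrable_coeFn f)).toL1 _
  map_add' f g := by
    rw [← Integrable.toL1_add, Integrable.toL1_eq_toL1_iff]
    refine (smul_comp_ae_congr hφ hw hν (Lp.coeFn_add f g)).trans ?_
    simp [Pi.add_def, smul_add]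
  map_smul' c f := by
    simp only [RingHom.id_apply]
    rw [← Integrable.toL1_smul, Integrable.toL1_eq_toL1_iff]
    refine (smul_comp_ae_congr hφ hw hν (Lp.coeFn_smul c f)).trans ?_
    refine Eventually.of_forall fun x => ?_
    simp [NNReal.smul_def, RCLike.real_smul_eq_coe_mul]
    ring
  norm_map' f := by
    simp only [LinearMap.coe_mk, AddHom.coe_mk]
    rw [L1.norm_eq_integral_norm, L1.norm_eq_integral_norm,
      integral_congr_ae (g := fun x => ‖w x • f (φ x)‖)
        (by filter_upwards [Integrable.coeFn_toL1 ((integrable_smul_comp_iff hφ hw hν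
          (Lp.aestronglyMeasurable f)).2 (L1.integrable_coeFn f))] with x hx; rw [hx])]
    have h1 : AEStronglyMeasurable (fun y => ‖f y‖) ν := (Lp.aestronglyMeasurable f).norm
    have h2 : ∀ g : β → ℝ, AEStronglyMeasurable g ν → ∫ y, g y ∂ν = ∫ x, w x • g (φ x) ∂μ := by
      intro g hg
      rw [hν] at hg ⊢
      rw [integral_map hφ.aemeasurable hg, integral_withDensity_eq_integral_smul hw]
    rw [h2 _ h1]
    refine integral_congr_ae (Eventually.of_forall fun x => ?_)
    simp [NNReal.smul_def, norm_smul]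

theorem weightedComp_coeFn (hφ : Measurable φ) (hw : Measurable w)
    (hν : ν = (μ.withDensity fun x => (w x : ℝ≥0∞)).map φ) (f : Lp 𝕜 1 ν) :
    weightedComp 𝕜 hφ hw hν f =ᵐ[μ] fun x => w x • f (φ x) :=
  Integrable.coeFn_toL1 ((integrable_smul_comp_iff hφ hw hν (Lp.aestronglyMeasurable f)).2
    (L1.integrable_coeFn f))

/-- Integrability of the candidate preimage comes for free from that of f, so only measurability and
the pointwise formula have to be checked. -/
theorem mem_range_weightedComp (hφ : Measurable φ) (hw : Measurable w)
    (hν : ν = (μ.withDensity fun x => (w x : ℝ≥0∞)).map φ) {f : Lp 𝕜 1 μ} {F : β → 𝕜}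
    (hF : AEStronglyMeasurable F ν) (h : f =ᵐ[μ] fun x => w x • F (φ x)) :
    f ∈ (weightedComp 𝕜 hφ hw hν).toLinearMap.range := by
  have hint : Integrable F ν := (integrable_smul_comp_iff hφ hw hν hF).1
    ((L1.integrable_coeFn f).congr h)
  refine ⟨hint.toL1 F, Lp.ext ?_⟩
  refine (weightedComp_coeFn hφ hw hν _).trans
    ((smul_comp_ae_congr hφ hw hν (Integrable.coeFn_toL1 hint)).trans h.symm)

theorem isClosed_range_linearIsometry {X Y : Type*} [NormedAddCommGroup X] [NormedSpace 𝕜 X]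
    [CompleteSpace X] [NormedAddCommGroup Y] [NormedSpace 𝕜 Y] (T : X →ₗᵢ[𝕜] Y) :
    IsClosed (T.toLinearMap.range : Set Y) := by
  simpa using! T.isometry.isClosedEmbedding.isClosed_range

theorem measurableSet_nonneg_scalar :
    MeasurableSet {z : 𝕜 | ∃ r : ℝ, 0 ≤ r ∧ z = (r : 𝕜)} := by
  have : {z : 𝕜 | ∃ r : ℝ, 0 ≤ r ∧ z = (r : 𝕜)} = {z | 0 ≤ RCLike.re z ∧ RCLike.im z = 0} := by
    ext z
    constructor
    · rintro ⟨r, hr, rfl⟩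
      simpa using hr
    · rintro ⟨h1, h2⟩
      exact ⟨RCLike.re z, h1, by apply RCLike.ext <;> simp [h2]⟩
  rw [this]
  exact ((isClosed_le continuous_const RCLike.continuous_re).inter
    (isClosed_eq RCLike.continuous_im continuous_const)).measurableSet

/-- Where w is nonzero one may divide by it; the set where w vanishes is invisible to ν. -/
theorem nonnegL1_weightedComp_iff (hφ : Measurable φ) (hw : Measurable w)
    (hν : ν = (μ.withDensity fun x => (w x : ℝ≥0∞)).map φ) (f : Lp 𝕜 1 ν) :
    NonnegL1 (weightedComp 𝕜 hφ hw hν f) ↔ NonnegL1 f := by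
  have hcoe := weightedComp_coeFn hφ hw hν f
  constructor
  · intro h
    have h1 : ∀ᵐ x ∂μ, w x ≠ 0 → ∃ r : ℝ, 0 ≤ r ∧ f (φ x) = (r : 𝕜) := by
      filter_upwards [h, hcoe] with x ⟨r, hr, hx⟩ hx' h0
      rw [hx'] at hx
      refine ⟨(w x : ℝ)⁻¹ * r, by positivity, ?_⟩
      rw [RCLike.ofReal_mul, ← hx, NNReal.smul_def, RCLike.real_smul_eq_coe_mul, ← mul_assoc,
        ← RCLike.ofReal_mul, inv_mul_cancel₀ (by exact_mod_cast h0)]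
      simp
    have h2 : ∀ᵐ y ∂((μ.withDensity fun x => (w x : ℝ≥0∞)).map φ),
        ∃ r : ℝ, 0 ≤ r ∧ f y = (r : 𝕜) := by
      refine (ae_map_iff hφ.aemeasurable
        ((Lp.stronglyMeasurable f).measurable measurableSet_nonneg_scalar)).2
        ((ae_withDensity_iff hw.coe_nnreal_ennreal).2 ?_)
      simpa using h1
    rwa [← hν] at h2
  · intro h
    filter_upwards [ae_comp_of_map_withDensity hφ hw hν h, hcoe] with x hx hx'
    by_cases h0 : w x = 0
    · exact ⟨0, le_rfl, by rw [hx', h0]; simp⟩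
    · obtain ⟨r, hr, hxr⟩ := hx h0
      refine ⟨w x * r, by positivity, ?_⟩
      rw [hx', hxr, NNReal.smul_def, RCLike.real_smul_eq_coe_mul, RCLike.ofReal_mul]

end WeightedComposition

/-! ### Atomless measures on the line and the unit interval. -/

section Atomless

open ProbabilityTheory

/-- A jump of the distribution function is the mass of a point. -/
theorem continuous_cdf (μ : Measure ℝ) [IsProbabilityMeasure μ] [NullSingletonClass μ] :
    Continuous (cdf μ) := by
  refine continuous_iff_continuousAt.2 fun x => ?_
  rw [(monotone_cdf μ).continuousAt_iff_leftLim_eq_rightLim, StieltjesFunction.rightLim_eq]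
  refine le_antisymm ((monotone_cdf μ).leftLim_le le_rfl) ?_
  have h := (cdf μ).measure_singleton x
  rw [measure_cdf, measure_singleton] at h
  exact sub_nonpos.1 (ENNReal.ofReal_eq_zero.1 h.symm)

theorem exists_cdf_eq (μ : Measure ℝ) [IsProbabilityMeasure μ] [NullSingletonClass μ] {y : ℝ}
    (h0 : 0 < y) (h1 : y < 1) : ∃ s, cdf μ s = y := by
  refine mem_range_of_exists_le_of_exists_ge (continuous_cdf μ) ?_ ?_
  · obtain ⟨a, ha⟩ := ((tendsto_cdf_atBot μ).eventually (gt_mem_nhds h0)).exists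
    exact ⟨a, ha.le⟩
  · obtain ⟨a, ha⟩ := ((tendsto_cdf_atTop μ).eventually (lt_mem_nhds h1)).exists
    exact ⟨a, ha.le⟩

/-- By continuity, values strictly between 0 and 1 are attained. If `cdf μ s = y`, the set contains
`Iic s`, of mass y; if `cdf μ s = a > y`, it is contained in `Iic s`, of mass a. -/
theorem measure_cdf_le (μ : Measure ℝ) [IsProbabilityMeasure μ] [NullSingletonClass μ] {y : ℝ}
    (h0 : 0 ≤ y) (h1 : y < 1) : μ {x | cdf μ x ≤ y} = ENNReal.ofReal y := by
  refine le_antisymm ?_ ?_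
  · refine le_of_forall_gt_imp_ge_of_dense fun a ha => ?_
    rcases le_or_gt 1 a with h | h
    · exact prob_le_one.trans h
    · have ha' : a ≠ ∞ := (h.trans_le le_top).ne
      have h2 : y < a.toReal := (ENNReal.ofReal_lt_iff_lt_toReal h0 ha').1 ha
      obtain ⟨s, hs⟩ := exists_cdf_eq μ (h0.trans_lt h2)
        (by simpa using (ENNReal.toReal_lt_toReal ha' ENNReal.one_ne_top).2 h)
      calc μ {x | cdf μ x ≤ y} ≤ μ (Iic s) := measure_mono fun x hx => by
            by_contra hxs
            have := monotone_cdf μ (not_le.1 hxs).le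
            rw [hs] at this
            exact absurd (this.trans hx) (not_le.2 h2)
        _ = a := by rw [← ofReal_cdf, hs, ENNReal.ofReal_toReal ha']
  · rcases h0.eq_or_lt with rfl | h0
    · simp
    · obtain ⟨s, hs⟩ := exists_cdf_eq μ h0 h1
      rw [← hs, ofReal_cdf]
      exact measure_mono fun x hx => monotone_cdf μ hx

/-- The distribution function of an atomless probability measure on the line transports it to
Lebesgue measure on the unit interval. -/
theorem map_cdf (μ : Measure ℝ) [IsProbabilityMeasure μ] [NullSingletonClass μ] :
    μ.map (cdf μ) = volume.restrict (Ioc (0 : ℝ) 1) := by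
  have hm : Measurable (cdf μ) := (monotone_cdf μ).measurable
  refine Measure.ext_of_Iic _ _ fun y => ?_
  rw [Measure.map_apply hm measurableSet_Iic, Measure.restrict_apply measurableSet_Iic]
  change μ {x | cdf μ x ≤ y} = _
  rcases lt_or_ge y 0 with h | h
  · have e1 : {x | cdf μ x ≤ y} = ∅ := by
      ext x; simpa using h.trans_le (cdf_nonneg μ x)
    have e2 : Iic y ∩ Ioc (0 : ℝ) 1 = ∅ := by
      ext x; simp only [mem_inter_iff, mem_Iic, mem_Ioc, mem_empty_iff_false, iff_false]
      intro h'; linarith [h'.1, h'.2.1]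
    rw [e1, e2]; simp
  rcases lt_or_ge y 1 with h1 | h1
  · have e2 : Iic y ∩ Ioc (0 : ℝ) 1 = Ioc 0 y := by
      ext x; simp only [mem_inter_iff, mem_Iic, mem_Ioc]
      constructor
      · rintro ⟨h1, h2, h3⟩; exact ⟨h2, h1⟩
      · rintro ⟨h2, h3⟩; exact ⟨h3, h2, by linarith⟩
    rw [e2, measure_cdf_le μ h h1]; simp
  · have e1 : {x | cdf μ x ≤ y} = univ := by
      ext x; simpa using (cdf_le_one μ x).trans h1
    have e2 : Iic y ∩ Ioc (0 : ℝ) 1 = Ioc 0 1 := by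
      ext x; simp only [mem_inter_iff, mem_Iic, mem_Ioc, and_iff_right_iff_imp]
      intro h'; linarith [h'.2]
    rw [e1, e2]; simp

variable (𝕜 : Type*) [RCLike 𝕜]

theorem exists_nonneg_equiv_of_surjective {α β : Type*} [MeasurableSpace α] [MeasurableSpace β]
    {μ : Measure α} {ν : Measure β} {φ : α → β} {w : α → ℝ≥0} (hφ : Measurable φ)
    (hw : Measurable w) (hν : ν = (μ.withDensity fun x => (w x : ℝ≥0∞)).map φ)
    (h : (weightedComp 𝕜 hφ hw hν).toLinearMap.range = ⊤) :
    ∃ T : Lp 𝕜 1 ν ≃ₗᵢ[𝕜] Lp 𝕜 1 μ, ∀ f, NonnegL1 (T f) ↔ NonnegL1 f := by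
  refine ⟨LinearIsometryEquiv.ofSurjective (weightedComp 𝕜 hφ hw hν)
    (LinearMap.range_eq_top.1 h), fun f => ?_⟩
  rw [LinearIsometryEquiv.coe_ofSurjective]
  exact nonnegL1_weightedComp_iff hφ hw hν f

theorem exists_nonneg_equiv_of_isProbabilityMeasure (μ : Measure ℝ) [IsProbabilityMeasure μ]
    [NullSingletonClass μ] :
    ∃ T : Lp 𝕜 1 (volume.restrict (Ioc (0 : ℝ) 1)) ≃ₗᵢ[𝕜] Lp 𝕜 1 μ,
      ∀ f, NonnegL1 (T f) ↔ NonnegL1 f := by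
  have hm : Measurable (cdf μ) := (monotone_cdf μ).measurable
  have hν : volume.restrict (Ioc (0 : ℝ) 1)
      = (μ.withDensity fun _ => ((1 : ℝ≥0) : ℝ≥0∞)).map (cdf μ) := by
    rw [← map_cdf μ]; simp
  refine exists_nonneg_equiv_of_surjective 𝕜 hm (w := fun _ => 1) measurable_const hν ?_
  -- The range contains the indicators of all preimages under the distribution function. A half-line
  -- differs from such a preimage by a null set only, because it is contained in it and has the same
  -- mass.
  have key : ∀ B : Set ℝ, MeasurableSet B → ContainsIndicator
      (weightedComp 𝕜 hm (w := fun _ => 1) measurable_const hν).toLinearMap.range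
      (cdf μ ⁻¹' B) := fun B hB => by
    refine ⟨hm hB, measure_ne_top _ _, mem_range_weightedComp hm measurable_const hν
      (F := B.indicator fun _ => 1) ?_ ?_⟩
    · exact (measurable_const.indicator hB).aestronglyMeasurable
    · refine indicatorConstLp_coeFn.trans (Eventually.of_forall fun x => ?_)
      simp only [one_smul]
      rfl
  refine eq_top_of_containsIndicator_Iic (A := fun _ => univ) (isClosed_range_linearIsometry _)
    monotone_const (by simp [iUnion_const]) (fun _ => key univ MeasurableSet.univ) fun _ x => ?_
  rw [inter_univ]
  refine (key (Iic (cdf μ x)) measurableSet_Iic).congr_ae measurableSet_Iic ?_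
  refine (ae_eq_of_subset_of_measure_ge (s := Iic x) (t := cdf μ ⁻¹' Iic (cdf μ x))
    (fun y hy => monotone_cdf μ hy) ?_
    measurableSet_Iic.nullMeasurableSet (measure_ne_top _ _)).symm
  rcases (cdf_le_one μ x).lt_or_eq with h | h
  · rw [← ofReal_cdf μ x]
    exact (measure_cdf_le μ (cdf_nonneg μ x) h).le
  · rw [← ofReal_cdf μ x, h]; simpa using prob_le_one

/-- A strictly positive integrable density, normalized, turns μ into a probability measure. As the
weight never vanishes, multiplication by it is onto. -/
theorem exists_nonneg_equiv_unitInterval (μ : Measure ℝ) [SigmaFinite μ] [NullSingletonClass μ]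
    (h0 : μ ≠ 0) :
    ∃ T : Lp 𝕜 1 (volume.restrict (Ioc (0 : ℝ) 1)) ≃ₗᵢ[𝕜] Lp 𝕜 1 μ,
      ∀ f, NonnegL1 (T f) ↔ NonnegL1 f := by
  obtain ⟨g, hg0, hgm, hg1⟩ := exists_pos_lintegral_lt_of_sigmaFinite μ one_ne_zero
  set c : ℝ≥0∞ := ∫⁻ x, g x ∂μ
  have hc0 : c ≠ 0 := by
    intro h
    rw [lintegral_eq_zero_iff hgm.coe_nnreal_ennreal] at h
    refine h0 (Measure.measure_univ_eq_zero.1 ?_)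
    have : ∀ᵐ x ∂μ, False := h.mono fun x hx => (hg0 x).ne' (by simpa using hx)
    simpa [ae_iff] using this
  have hct : c ≠ ∞ := (hg1.trans_le le_top).ne
  let w : ℝ → ℝ≥0 := fun x => g x / c.toNNReal
  have hw : Measurable w := hgm.div_const _
  have hcN : c.toNNReal ≠ 0 := by simp [ENNReal.toNNReal_eq_zero_iff, hc0, hct]
  have hw0 : ∀ x, w x ≠ 0 := fun x => div_ne_zero (hg0 x).ne' hcN
  let κ : Measure ℝ := μ.withDensity fun x => (w x : ℝ≥0∞)
  have hκ : IsProbabilityMeasure κ := by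
    constructor
    rw [withDensity_apply _ MeasurableSet.univ, Measure.restrict_univ]
    have : ∀ x, (w x : ℝ≥0∞) = g x * c⁻¹ := fun x => by
      simp only [w]
      rw [ENNReal.coe_div hcN, ENNReal.coe_toNNReal hct, div_eq_mul_inv]
    simp_rw [this]
    rw [lintegral_mul_const _ hgm.coe_nnreal_ennreal]
    exact ENNReal.mul_inv_cancel hc0 hct
  have hκ' : NullSingletonClass κ := nullSingletonClass_withDensity _
  obtain ⟨T₁, hT₁⟩ := exists_nonneg_equiv_of_isProbabilityMeasure 𝕜 κ
  have hν : κ = (μ.withDensity fun x => (w x : ℝ≥0∞)).map id := by rw [Measure.map_id]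
  obtain ⟨T₂, hT₂⟩ := exists_nonneg_equiv_of_surjective 𝕜 measurable_id hw hν (by
    refine eq_top_iff.2 fun f _ => ?_
    refine mem_range_weightedComp measurable_id hw hν (F := fun x => (w x)⁻¹ • f x) ?_ ?_
    · exact (hw.inv.aestronglyMeasurable).smul
        ((Lp.aestronglyMeasurable f).mono_ac (withDensity_absolutelyContinuous _ _))
    · exact Eventually.of_forall fun x => by simp [smul_smul, hw0 x])
  exact ⟨T₁.trans T₂, fun f => by simp [hT₂, hT₁]⟩

theorem exists_nonneg_equiv_L1Pos (μ : Measure ℝ) [SigmaFinite μ] [NullSingletonClass μ]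
    (h0 : μ ≠ 0) : ∃ T : L1Pos 𝕜 ≃ₗᵢ[𝕜] Lp 𝕜 1 μ, ∀ f, NonnegL1 (T f) ↔ NonnegL1 f := by
  obtain ⟨T₁, hT₁⟩ := exists_nonneg_equiv_unitInterval 𝕜 volPos
    (by rw [Ne, Measure.restrict_eq_zero]; simp)
  obtain ⟨T₂, hT₂⟩ := exists_nonneg_equiv_unitInterval 𝕜 μ h0
  refine ⟨T₁.symm.trans T₂, fun f => ?_⟩
  rw [LinearIsometryEquiv.trans_apply, hT₂, ← hT₁, LinearIsometryEquiv.apply_symm_apply]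

end Atomless

/-! ### Reduction of separable L₁ spaces to L₁(0,∞) and atoms. -/

section Separable

variable (𝕜 : Type*) [RCLike 𝕜]

/-- A separable `L₁` space is generated by the indicators of a sequence of sets. -/
theorem exists_seq_generating_indicators {α : Type*} [MeasurableSpace α] (μ : Measure α)
    [TopologicalSpace.SeparableSpace (Lp 𝕜 1 μ)] :
    ∃ E : ℕ → Set α, (∀ n, MeasurableSet (E n)) ∧ (∀ n, μ (E n) ≠ ∞) ∧
      ∀ Z : Submodule 𝕜 (Lp 𝕜 1 μ), IsClosed (Z : Set (Lp 𝕜 1 μ)) →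
        (∀ n, ContainsIndicator Z (E n)) → Z = ⊤ := by
  let I : Set (Lp 𝕜 1 μ) := {f | ∃ (S : Set α) (hS : MeasurableSet S) (hμ : μ S ≠ ∞),
    f = indicatorConstLp 1 hS hμ (1 : 𝕜)}
  obtain ⟨t, htI, htc, hIt⟩ :=
    (TopologicalSpace.IsSeparable.of_separableSpace I).exists_countable_dense_subset
  have hne : t.Nonempty := by
    have : (indicatorConstLp 1 MeasurableSet.empty (by simp) (1 : 𝕜) : Lp 𝕜 1 μ) ∈ closure t :=
      hIt ⟨∅, _, _, rfl⟩
    exact closure_nonempty_iff.1 ⟨_, this⟩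
  obtain ⟨f, rfl⟩ := htc.exists_eq_range hne
  have hf : ∀ n, f n ∈ I := fun n => htI (mem_range_self n)
  choose E hE hμE hfE using hf
  refine ⟨E, hE, hμE, fun Z hZ hEZ => eq_top_of_containsIndicator hZ fun S hS hμ => ?_⟩
  refine ⟨hS, hμ, closure_minimal ?_ hZ (hIt ⟨S, hS, hμ, rfl⟩)⟩
  rintro _ ⟨n, rfl⟩
  rw [hfE]
  exact (hEZ n).2.2

/-- A separable `L₁` space is isometric, as an ordered space, to the `L₁` space of a finite
measure on the line. -/
theorem exists_nonneg_equiv_real {α : Type*} [MeasurableSpace α] (μ : Measure α)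
    [TopologicalSpace.SeparableSpace (Lp 𝕜 1 μ)] :
    ∃ (κ : Measure ℝ) (_ : IsFiniteMeasure κ) (T : Lp 𝕜 1 κ ≃ₗᵢ[𝕜] Lp 𝕜 1 μ),
      ∀ f, NonnegL1 (T f) ↔ NonnegL1 f := by
  obtain ⟨E, hE, hμE, htop⟩ := exists_seq_generating_indicators 𝕜 μ
  classical
  -- A point is coded by the sequence of its memberships in the sets `E n`, and the Cantor space is
  -- embedded measurably in the line; `E n` becomes the preimage of `B n`.
  let ψ : α → ℕ → Bool := fun x n => decide (x ∈ E n)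
  have hψ : Measurable ψ := measurable_pi_lambda _ fun n => by
    refine measurable_to_bool ?_
    convert hE n using 1
    ext x; simp [ψ]
  have hemb := measurableEmbedding_embeddingReal (ℕ → Bool)
  let φ : α → ℝ := fun x => embeddingReal (ℕ → Bool) (ψ x)
  have hφ : Measurable φ := hemb.measurable.comp hψ
  let B : ℕ → Set ℝ := fun n => embeddingReal (ℕ → Bool) '' {p | p n = true}
  have hB : ∀ n, MeasurableSet (B n) := fun n =>
    hemb.measurableSet_image.2
      ((measurable_pi_apply (X := fun _ : ℕ => Bool) n) (measurableSet_singleton true))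
  have hφB : ∀ n x, φ x ∈ B n ↔ x ∈ E n := fun n x => by
    simp only [φ, B, hemb.injective.mem_set_image]
    simp [ψ]
  -- The summand `μ (E n)` makes the weight integrable, and the added 1 makes Σ ε_n finite, hence V
  -- finite everywhere.
  obtain ⟨ε, hε0, hε⟩ := ENNReal.exists_pos_tsum_mul_lt_of_countable one_ne_zero
    (fun n => μ (E n) + 1) (fun n => by simp [hμE n])
  let V : ℝ → ℝ≥0∞ := fun y => ∑' n, (B n).indicator (fun _ => (ε n : ℝ≥0∞)) y
  have hVm : Measurable V := Measurable.tsum fun n => measurable_const.indicator (hB n)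
  have hVt : ∀ y, V y ≠ ∞ := fun y => by
    refine (lt_of_le_of_lt (ENNReal.tsum_le_tsum fun n => ?_) (hε.trans_le le_top)).ne
    calc (B n).indicator (fun _ => (ε n : ℝ≥0∞)) y ≤ ε n := indicator_le_self _ _ _
      _ ≤ (μ (E n) + 1) * ε n := le_mul_of_one_le_left' le_add_self
  have hV0 : ∀ n y, y ∈ B n → V y ≠ 0 := fun n y hy h => by
    have := ENNReal.tsum_eq_zero.1 h n
    rw [indicator_of_mem hy] at this
    exact (hε0 n).ne' (by simpa using this)
  let w : α → ℝ≥0 := fun x => (V (φ x)).toNNReal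
  have hw : Measurable w := (hVm.comp hφ).ennreal_toNNReal
  have hwV : ∀ x, (w x : ℝ≥0∞) = V (φ x) := fun x => ENNReal.coe_toNNReal (hVt _)
  have hfin : ∫⁻ x, w x ∂μ ≠ ∞ := by
    have e : ∀ x, (w x : ℝ≥0∞) = ∑' n, (E n).indicator (fun _ => (ε n : ℝ≥0∞)) x := fun x => by
      simp only [hwV, V, indicator_apply, hφB]
    simp_rw [e]
    rw [lintegral_tsum fun n => (measurable_const.indicator (hE n)).aemeasurable]
    refine (lt_of_le_of_lt (ENNReal.tsum_le_tsum fun n => ?_) (hε.trans_le le_top)).ne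
    rw [lintegral_indicator_const (hE n), mul_comm]
    gcongr
    exact le_self_add
  have hfm : IsFiniteMeasure (μ.withDensity fun x => (w x : ℝ≥0∞)) :=
    isFiniteMeasure_withDensity hfin
  refine ⟨(μ.withDensity fun x => (w x : ℝ≥0∞)).map φ, inferInstance,
    exists_nonneg_equiv_of_surjective 𝕜 hφ hw rfl
      (htop _ (isClosed_range_linearIsometry _) fun n => ⟨hE n, hμE n,
        mem_range_weightedComp hφ hw rfl
          -- The weight is V ∘ φ, which is nonzero on `E n`, so dividing the indicator of `B n` by V
          -- gives the preimage of the indicator of `E n`.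
          (F := (B n).indicator fun y => ((V y).toNNReal)⁻¹ • (1 : 𝕜)) ?_ ?_⟩)⟩
  · exact ((hVm.ennreal_toNNReal.inv.smul_const (1 : 𝕜)).indicator (hB n)).aestronglyMeasurable
  · refine indicatorConstLp_coeFn.trans (Eventually.of_forall fun x => ?_)
    by_cases hx : x ∈ E n
    · have hx' := (hφB n x).2 hx
      have h0 : w x ≠ 0 := fun h => hV0 n _ hx' (by rw [← hwV, h]; simp)
      simp only [indicator_of_mem hx, indicator_of_mem hx', smul_smul]
      change (1 : 𝕜) = (w x * (w x)⁻¹) • (1 : 𝕜)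
      rw [mul_inv_cancel₀ h0, one_smul]
    · have hx' : φ x ∉ B n := fun h => hx ((hφB n x).1 h)
      simp [hx, hx']

/-- The value of an integrable function at an atom, as a continuous functional. -/
noncomputable def atomEval {α : Type*} [MeasurableSpace α] [MeasurableSingletonClass α]
    (μ : Measure α) [IsFiniteMeasure μ] (a : α) (ha : μ {a} ≠ 0) : StrongDual 𝕜 (Lp 𝕜 1 μ) :=
  LinearMap.mkContinuous
    { toFun := fun f => f a
      map_add' := fun f g => by
        -- An identity valid almost everywhere holds at an atom, so point evaluation respects the
        -- algebra of classes.
        by_contra h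
        exact ha (measure_mono_null (singleton_subset_iff.2 h) (Lp.coeFn_add f g))
      map_smul' := fun c f => by
        by_contra h
        exact ha (measure_mono_null (singleton_subset_iff.2 h) (Lp.coeFn_smul c f)) }
    (μ.real {a})⁻¹ (fun f => by
      have h0 : 0 < μ.real {a} := (measureReal_nonneg).lt_of_ne'
        (by simpa [measureReal_eq_zero_iff] using ha)
      rw [inv_mul_eq_div, le_div_iff₀ h0, L1.norm_eq_integral_norm]
      have h1 := setIntegral_le_integral (s := {a}) (L1.integrable_coeFn f).norm
        (Eventually.of_forall fun x => norm_nonneg _)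
      rw [integral_singleton, smul_eq_mul, mul_comm] at h1
      exact h1)

theorem NonnegL1.indicatorConstLp {α : Type*} [MeasurableSpace α] {μ : Measure α} {S : Set α}
    (hS : MeasurableSet S) (hμ : μ S ≠ ∞) :
    NonnegL1 (MeasureTheory.indicatorConstLp 1 hS hμ (1 : 𝕜)) := by
  filter_upwards [indicatorConstLp_coeFn (p := 1) (hs := hS) (hμs := hμ) (c := (1 : 𝕜))] with x hx
  rw [hx]
  by_cases h : x ∈ S
  · exact ⟨1, zero_le_one, by simp [h]⟩
  · exact ⟨0, le_rfl, by simp [h]⟩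

/-- The atoms form a countable set A, and L₁(μ) is the direct sum of L₁ of the atomless restriction
to the complement and the closed span of the atom indicators, where expansions converge absolutely.
-/
theorem hasNonnegSchauderBasis_of_isFiniteMeasure (μ : Measure ℝ) [IsFiniteMeasure μ]
    (b : SchauderBasis 𝕜 (L1Pos 𝕜)) (hb : ∀ i, NonnegL1 (b i)) : HasNonnegSchauderBasis 𝕜 μ := by
  classical
  let A : Set ℝ := {x | 0 < μ {x}}
  have hAc : A.Countable := by
    have := Measure.countable_meas_level_set_pos (μ := μ) (g := id) measurable_id
    simpa [A] using this
  have hAm : MeasurableSet A := hAc.measurableSet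
  have hAcm : MeasurableSet Aᶜ := hAm.compl
  have hc : Countable A := hAc.to_subtype
  have hA0 : ∀ a : A, μ {(a : ℝ)} ≠ 0 := fun a => a.2.ne'
  have hat : ∀ {p : ℝ → Prop}, (∀ᵐ x ∂μ, p x) → ∀ a : A, p a := fun {p} hp a => by
    by_contra h
    exact hA0 a (measure_mono_null (singleton_subset_iff.2 h) hp)
  let w : ℝ → ℝ≥0 := Aᶜ.indicator 1
  have hw : Measurable w := measurable_one.indicator hAcm
  have hν : μ.restrict Aᶜ = (μ.withDensity fun x => (w x : ℝ≥0∞)).map id := by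
    rw [Measure.map_id, ← withDensity_indicator_one hAcm]
    congr 1
    ext x
    by_cases hx : x ∈ Aᶜ <;> simp [w, hx]
  have hκ : NullSingletonClass (μ.restrict Aᶜ) := ⟨fun x => by
    rw [Measure.restrict_apply (measurableSet_singleton x)]
    by_cases hx : x ∈ A
    · have : {x} ∩ Aᶜ = ∅ := by ext y; simp; rintro rfl; exact hx
      rw [this, measure_empty]
    · refine measure_mono_null inter_subset_left ?_
      simpa [A] using hx⟩
  let ι : Lp 𝕜 1 (μ.restrict Aᶜ) →L[𝕜] Lp 𝕜 1 μ :=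
    (weightedComp 𝕜 measurable_id hw hν).toContinuousLinearMap
  have hι : ∀ f, ι f =ᵐ[μ] fun x => w x • f x := fun f =>
    weightedComp_coeFn measurable_id hw hν f
  let R : Lp 𝕜 1 μ →L[𝕜] Lp 𝕜 1 (μ.restrict Aᶜ) := LpToLpRestrictCLM ℝ 𝕜 𝕜 μ 1 Aᶜ
  have hR : ∀ f, R f =ᵐ[μ.restrict Aᶜ] f := fun f => LpToLpRestrictCLM_coeFn 𝕜 Aᶜ f
  let e : A → Lp 𝕜 1 μ := fun a =>
    indicatorConstLp 1 (measurableSet_singleton (a : ℝ)) (measure_ne_top _ _) (1 : 𝕜)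
  let δ : A → StrongDual 𝕜 (Lp 𝕜 1 μ) := fun a => atomEval 𝕜 μ a (hA0 a)
  have hRι : ∀ f, R (ι f) = f := fun f => Lp.ext <| by
    filter_upwards [hR (ι f), ae_restrict_of_ae (hι f), ae_restrict_mem hAcm] with x h1 h2 h3
    rw [h1, h2]
    simp only [w, indicator_of_mem h3, Pi.one_apply, one_smul]
  have he : ∀ a, ⇑(e a) =ᵐ[μ] ({(a : ℝ)} : Set ℝ).indicator fun _ => (1 : 𝕜) := fun a =>
    indicatorConstLp_coeFn
  have hδe : ∀ a a', δ a (e a') = if a = a' then 1 else 0 := fun a a' => by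
    change e a' a = _
    rw [hat (he a') a]
    by_cases h : a = a'
    · simp [h]
    · have : (a : ℝ) ≠ a' := fun h' => h (Subtype.ext h')
      simp [h, this]
  have hδι : ∀ a f, δ a (ι f) = 0 := fun a f => by
    change ι f a = 0
    rw [hat (hι f) a]
    simp [w]
  have hRe : ∀ a, R (e a) = 0 := fun a => Lp.ext <| by
    filter_upwards [hR (e a), ae_restrict_of_ae (he a), ae_restrict_mem hAcm,
      Lp.coeFn_zero 𝕜 1 (μ.restrict Aᶜ)] with x h1 h2 h3 h4
    rw [h1, h2, h4]
    have : x ≠ a := by rintro rfl; exact h3 a.2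
    simp [this]
  -- A class is determined by its restriction off the atoms and its values at them. This identifies
  -- the sum of the atomic series below.
  have hzero : ∀ f : Lp 𝕜 1 μ, R f = 0 → (∀ a, δ a f = 0) → f = 0 := fun f h1 h2 => Lp.ext <| by
    have h3 : ∀ᵐ x ∂(μ.restrict Aᶜ), f x = 0 := by
      have := hR f
      rw [h1] at this
      filter_upwards [this, Lp.coeFn_zero 𝕜 1 (μ.restrict Aᶜ)] with x h1 h2
      rw [← h1, h2]; rfl
    rw [ae_restrict_iff' hAcm] at h3
    filter_upwards [h3, Lp.coeFn_zero 𝕜 1 μ] with x h3 h4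
    rw [h4]
    by_cases hx : x ∈ A
    · exact h2 ⟨x, hx⟩
    · exact h3 hx
  have hsum : ∀ f, HasSum (fun a => δ a f • e a) (f - ι (R f)) := fun f => by
    have hs : Summable fun a => δ a f • e a := by
      refine Summable.of_norm (summable_of_sum_le (c := ‖f‖) (fun a => norm_nonneg _) fun u => ?_)
      have h1 := setIntegral_le_integral
        (s := ((u.map (Function.Embedding.subtype _) : Finset ℝ) : Set ℝ))
        (L1.integrable_coeFn f).norm (Eventually.of_forall fun x => norm_nonneg _)
      rw [setIntegral_finset _ (L1.integrable_coeFn f).norm.integrableOn, Finset.sum_map] at h1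
      rw [L1.norm_eq_integral_norm]
      refine le_trans (Finset.sum_le_sum fun a _ => ?_) h1
      rw [norm_smul, norm_indicatorConstLp one_ne_zero ENNReal.one_ne_top]
      change ‖f a‖ * _ ≤ μ.real {(a : ℝ)} * ‖f a‖
      simp [mul_comm]
    obtain ⟨s, hs⟩ := hs
    have : f - ι (R f) - s = 0 := hzero _
      (by
        have h1 : HasSum (fun a => R (δ a f • e a)) (R s) := R.hasSum hs
        simp only [map_smul, hRe, smul_zero] at h1
        rw [map_sub, map_sub, hRι, ← hasSum_zero.unique h1]; simp)
      (fun a => by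
        have h1 : HasSum (fun a' => δ a (δ a' f • e a')) (δ a s) := (δ a).hasSum hs
        simp only [map_smul, hδe, smul_eq_mul, mul_ite, mul_one, mul_zero] at h1
        have h2 := (hasSum_ite_eq a (δ a f))
        have h3 : δ a s = δ a f := h1.unique (by
          convert h2 using 2 with a'
          by_cases h : a = a'
          · subst h; simp
          · simp [h, Ne.symm h])
        rw [map_sub, map_sub, hδι, h3]; simp)
    rwa [sub_eq_zero.1 this]
  have hen : ∀ a, NonnegL1 (e a) := fun a => NonnegL1.indicatorConstLp 𝕜 _ _
  -- The purely atomic case is separate: only there can the space be finite dimensional.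
  by_cases h0 : μ.restrict Aᶜ = 0
  · have hR0 : ∀ f, ι (R f) = 0 := fun f => by
      have : R f = 0 := Lp.ext (by
        have : ∀ p : ℝ → Prop, ∀ᵐ x ∂μ.restrict Aᶜ, p x := fun p => by rw [h0]; simp
        exact this _)
      rw [this, map_zero]
    rcases exists_basis_of_hasSum e δ hδe (fun f => by simpa [hR0] using hsum f) with
      ⟨B, hB⟩ | ⟨n, B, hB⟩
    · refine Or.inl ⟨B, fun i => ?_⟩
      obtain ⟨a, ha⟩ := hB i
      rw [ha]; exact hen a
    · refine Or.inr ⟨n, B, fun i => ?_⟩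
      obtain ⟨a, ha⟩ := hB i
      rw [ha]; exact hen a
  · obtain ⟨T, hT⟩ := exists_nonneg_equiv_L1Pos 𝕜 (μ.restrict Aᶜ) h0
    obtain ⟨B, hB⟩ := exists_schauderBasis_of_split
      (mapSchauderBasis b T.toContinuousLinearEquiv) ι R hRι e δ hδe hδι hRe hsum
    refine Or.inl ⟨B, fun i => ?_⟩
    rcases hB i with ⟨j, hj⟩ | ⟨a, ha⟩
    · rw [hj]
      exact (nonnegL1_weightedComp_iff measurable_id hw hν _).2 ((hT _).2 (hb j))
    · rw [ha]; exact hen a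

theorem hasNonnegSchauderBasis_of_separable {α : Type*} [MeasurableSpace α] (μ : Measure α)
    [TopologicalSpace.SeparableSpace (Lp 𝕜 1 μ)] (b : SchauderBasis 𝕜 (L1Pos 𝕜))
    (hb : ∀ i, NonnegL1 (b i)) : HasNonnegSchauderBasis 𝕜 μ := by
  obtain ⟨κ, hκ, T, hT⟩ := exists_nonneg_equiv_real 𝕜 μ
  rcases hasNonnegSchauderBasis_of_isFiniteMeasure 𝕜 κ b hb with ⟨B, hB⟩ | ⟨n, B, hB⟩
  · exact Or.inl ⟨mapSchauderBasis B T.toContinuousLinearEquiv, fun i => (hT _).2 (hB i)⟩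
  · exact Or.inr ⟨n, B.map T.toLinearEquiv, fun i => by
      rw [Module.Basis.map_apply]; exact (hT _).2 (hB i)⟩

end Separable

/-! ### Dyadic intervals, Haar functions and their integrals. -/

section Haar

/-- The open dyadic interval `(j + i / 2 ^ n, j + (i + 1) / 2 ^ n)`. -/
def dyadicIoo (j n i : ℕ) : Set ℝ :=
  Ioo ((j : ℝ) + (i : ℝ) / 2 ^ n) ((j : ℝ) + ((i : ℝ) + 1) / 2 ^ n)

theorem measurableSet_dyadicIoo (j n i : ℕ) : MeasurableSet (dyadicIoo j n i) := measurableSet_Ioo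

/-- After rescaling by 2 ^ n the endpoints are integers, which reduces comparisons between levels to
arithmetic in ℕ. -/
theorem mem_dyadicIoo {j n i : ℕ} {t : ℝ} :
    t ∈ dyadicIoo j n i ↔ (i : ℝ) < 2 ^ n * (t - j) ∧ 2 ^ n * (t - j) < i + 1 := by
  have h : (0 : ℝ) < 2 ^ n := by positivity
  rw [dyadicIoo, mem_Ioo]
  have e1 : (j : ℝ) + i / 2 ^ n < t ↔ (i : ℝ) < 2 ^ n * (t - j) := by
    rw [← lt_sub_iff_add_lt', div_lt_iff₀ h, mul_comm]
  have e2 : t < (j : ℝ) + (i + 1) / 2 ^ n ↔ 2 ^ n * (t - j) < i + 1 := by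
    rw [← sub_lt_iff_lt_add', lt_div_iff₀ h, mul_comm]
  rw [e1, e2]

/-- On a dyadic interval the membership in a coarser dyadic interval is constant. -/
theorem mem_dyadicIoo_coarser {j n i m i' : ℕ} {t : ℝ} (ht : t ∈ dyadicIoo j n i) (h : m ≤ n) :
    t ∈ dyadicIoo j m i' ↔ i' * 2 ^ (n - m) ≤ i ∧ i < (i' + 1) * 2 ^ (n - m) := by
  rw [mem_dyadicIoo] at ht ⊢
  have hd : (0 : ℝ) < 2 ^ (n - m) := by positivity
  have e : (2 : ℝ) ^ n * (t - j) = (2 ^ m * (t - j)) * 2 ^ (n - m) := by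
    rw [mul_right_comm, ← pow_add, Nat.add_sub_cancel' h]
  rw [e] at ht
  have e1 : (i' : ℝ) < 2 ^ m * (t - j) ↔ i' * 2 ^ (n - m) ≤ i := by
    rw [← mul_lt_mul_iff_left₀ hd]
    constructor
    · intro h'
      have : (i' * 2 ^ (n - m) : ℝ) < i + 1 := h'.trans ht.2
      exact Nat.lt_succ_iff.1 (by exact_mod_cast this)
    · intro h'
      exact lt_of_le_of_lt (by exact_mod_cast h') ht.1
  have e2 : 2 ^ m * (t - j) < (i' : ℝ) + 1 ↔ i < (i' + 1) * 2 ^ (n - m) := by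
    rw [← mul_lt_mul_iff_left₀ hd]
    constructor
    · intro h'
      have : (i : ℝ) < (i' + 1) * 2 ^ (n - m) := ht.1.trans h'
      exact_mod_cast this
    · intro h'
      refine lt_of_lt_of_le ht.2 ?_
      have : i + 1 ≤ (i' + 1) * 2 ^ (n - m) := h'
      exact_mod_cast this
  rw [e1, e2]

theorem dyadicIoo_subset_unit {j n i : ℕ} (hi : i < 2 ^ n) :
    dyadicIoo j n i ⊆ Ioo (j : ℝ) (j + 1) := by
  intro t ht
  rw [mem_dyadicIoo] at ht
  have h : (0 : ℝ) < 2 ^ n := by positivity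
  have h1 : (i : ℝ) + 1 ≤ 2 ^ n := by exact_mod_cast hi
  have h0 : (0 : ℝ) ≤ i := Nat.cast_nonneg i
  constructor
  · have : 0 < 2 ^ n * (t - j) := h0.trans_lt ht.1
    linarith [(mul_pos_iff_of_pos_left h).1 this]
  · have : 2 ^ n * (t - j) < 2 ^ n * 1 := by linarith [ht.2]
    linarith [lt_of_mul_lt_mul_left this h.le]

theorem dyadicIoo_zero (j : ℕ) : dyadicIoo j 0 0 = Ioo (j : ℝ) (j + 1) := by
  simp [dyadicIoo]

theorem haarFun_eq (k : HaarIndex) (t : ℝ) : haarFun k t =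
    (dyadicIoo k.1 (k.2.1 + 1) (2 * k.2.2)).indicator (fun _ => (2 : ℝ) ^ k.2.1) t
    - (dyadicIoo k.1 (k.2.1 + 1) (2 * k.2.2 + 1)).indicator (fun _ => (2 : ℝ) ^ k.2.1) t := by
  have e : ((2 * (k.2.2 : ℕ) : ℝ) + 1 + 1) = 2 * (k.2.2 : ℕ) + 2 := by ring
  simp only [haarFun, dyadicIoo]
  push_cast
  rw [e]

/-- The interval that carries the Haar function with index `k`. -/
def haarSupp (k : HaarIndex) : Set ℝ := dyadicIoo k.1 k.2.1 k.2.2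

theorem left_subset_haarSupp (j n i : ℕ) : dyadicIoo j (n + 1) (2 * i) ⊆ dyadicIoo j n i := by
  intro t ht
  rw [mem_dyadicIoo_coarser ht (Nat.le_succ n)]
  simp; omega

theorem right_subset_haarSupp (j n i : ℕ) :
    dyadicIoo j (n + 1) (2 * i + 1) ⊆ dyadicIoo j n i := by
  intro t ht
  rw [mem_dyadicIoo_coarser ht (Nat.le_succ n)]
  simp; omega

theorem notMem_of_mem_dyadicIoo {j n i i' : ℕ} (h : i ≠ i') {t : ℝ} (ht : t ∈ dyadicIoo j n i) :
    t ∉ dyadicIoo j n i' := by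
  rw [mem_dyadicIoo_coarser ht le_rfl]
  simp; omega

theorem haarFun_of_notMem {k : HaarIndex} {t : ℝ} (ht : t ∉ haarSupp k) : haarFun k t = 0 := by
  rw [haarFun_eq, indicator_of_notMem fun h => ht (left_subset_haarSupp _ _ _ h),
    indicator_of_notMem fun h => ht (right_subset_haarSupp _ _ _ h), sub_zero]

theorem haarSupp_subset (k : HaarIndex) : haarSupp k ⊆ Ioo (k.1 : ℝ) (k.1 + 1) :=
  dyadicIoo_subset_unit k.2.2.2

theorem notMem_haarSupp_of_ne {k k' : HaarIndex} (h : k.1 ≠ k'.1) {t : ℝ} (ht : t ∈ haarSupp k) :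
    t ∉ Ioo (k'.1 : ℝ) (k'.1 + 1) := by
  have h1 := haarSupp_subset k ht
  intro h2
  have h3 : (k.1 : ℝ) < k'.1 + 1 := h1.1.trans h2.2
  have h4 : (k'.1 : ℝ) < k.1 + 1 := h2.1.trans h1.2
  have h5 : k.1 < k'.1 + 1 := by exact_mod_cast h3
  have h6 : k'.1 < k.1 + 1 := by exact_mod_cast h4
  omega

/-- A Haar function is constant on the interval of any Haar function that comes later in the
lexicographic order, or that lives on another unit interval. -/
theorem haarFun_const_on {k k' : HaarIndex} (h : k'.1 = k.1 → HaarLex k'.2 k.2) :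
    ∃ c, ∀ t ∈ haarSupp k, haarFun k' t = c := by
  classical
  by_cases hj : k'.1 = k.1
  · rcases h hj with h1 | ⟨h1, h2⟩
    · refine ⟨(if 2 * (k'.2.2 : ℕ) * 2 ^ (k.2.1 - (k'.2.1 + 1)) ≤ k.2.2 ∧
          (k.2.2 : ℕ) < (2 * k'.2.2 + 1) * 2 ^ (k.2.1 - (k'.2.1 + 1)) then 2 ^ k'.2.1 else 0)
        - (if (2 * k'.2.2 + 1) * 2 ^ (k.2.1 - (k'.2.1 + 1)) ≤ (k.2.2 : ℕ) ∧
          (k.2.2 : ℕ) < (2 * k'.2.2 + 1 + 1) * 2 ^ (k.2.1 - (k'.2.1 + 1))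
          then 2 ^ k'.2.1 else 0), fun t ht => ?_⟩
      have ht' : t ∈ dyadicIoo k.1 k.2.1 k.2.2 := ht
      rw [haarFun_eq, hj]
      simp only [indicator_apply, mem_dyadicIoo_coarser ht' (Nat.succ_le_of_lt h1)]
    · refine ⟨0, fun t ht => haarFun_of_notMem ?_⟩
      have e : haarSupp k' = dyadicIoo k.1 k.2.1 k'.2.2 := by simp only [haarSupp, hj, h1]
      rw [e]
      exact notMem_of_mem_dyadicIoo h2.ne' ht
  · exact ⟨0, fun t ht => haarFun_of_notMem fun h' =>
      notMem_haarSupp_of_ne (Ne.symm hj) ht (haarSupp_subset k' h')⟩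

theorem volPos_dyadicIoo {j n i : ℕ} (S : Set ℝ) (hS : dyadicIoo j n i ⊆ S) :
    (volPos.restrict S).real (dyadicIoo j n i) = 1 / 2 ^ n := by
  have h0 : dyadicIoo j n i ⊆ Ioi 0 := fun t ht => by
    refine lt_of_le_of_lt ?_ ht.1
    positivity
  rw [measureReal_def, Measure.restrict_apply (measurableSet_dyadicIoo j n i),
    inter_eq_left.2 hS, Measure.restrict_apply (measurableSet_dyadicIoo j n i),
    inter_eq_left.2 h0, dyadicIoo, Real.volume_Ioo, ENNReal.toReal_ofReal]
  · ring
  · have : (0 : ℝ) < 1 / 2 ^ n := by positivity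
    have e : (j : ℝ) + (i + 1) / 2 ^ n - (j + i / 2 ^ n) = 1 / 2 ^ n := by ring
    rw [e]; exact this.le

theorem volPos_dyadicIoo_ne_top (j n i : ℕ) : volPos (dyadicIoo j n i) ≠ ∞ :=
  ((Measure.restrict_apply_le _ _).trans_lt (by simp [dyadicIoo])).ne

theorem integrable_indicator_dyadicIoo (j n i : ℕ) (c : ℝ) :
    Integrable ((dyadicIoo j n i).indicator fun _ => c) volPos :=
  memLp_one_iff_integrable.1 (memLp_indicator_Ioo _ _ c)

theorem setIntegral_indicator_dyadicIoo {j n i : ℕ} {S : Set ℝ} (hS : dyadicIoo j n i ⊆ S)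
    (c : ℝ) : ∫ t in S, (dyadicIoo j n i).indicator (fun _ => c) t ∂volPos = c / 2 ^ n := by
  rw [integral_indicator_const c (measurableSet_dyadicIoo j n i), volPos_dyadicIoo S hS,
    smul_eq_mul]
  ring

/-- The identity holds at every point: the two open halves are disjoint, and both sides vanish at
the midpoint. -/
theorem abs_haarFun (k : HaarIndex) (t : ℝ) : |haarFun k t| =
    (dyadicIoo k.1 (k.2.1 + 1) (2 * k.2.2)).indicator (fun _ => (2 : ℝ) ^ k.2.1) t
    + (dyadicIoo k.1 (k.2.1 + 1) (2 * k.2.2 + 1)).indicator (fun _ => (2 : ℝ) ^ k.2.1) t := by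
  rw [haarFun_eq]
  by_cases h : t ∈ dyadicIoo k.1 (k.2.1 + 1) (2 * k.2.2)
  · rw [indicator_of_mem h,
      indicator_of_notMem (notMem_of_mem_dyadicIoo (Nat.succ_ne_self _).symm h), sub_zero,
      add_zero, abs_of_pos (by positivity)]
  · rw [indicator_of_notMem h, zero_sub, zero_add, abs_neg, abs_of_nonneg]
    exact indicator_nonneg (fun _ _ => by positivity) _

theorem integrable_haarFun (k : HaarIndex) : Integrable (haarFun k) volPos :=
  memLp_one_iff_integrable.1 (memLp_haarFun k)

theorem setIntegral_haarFun (k : HaarIndex) {S : Set ℝ} (hS : haarSupp k ⊆ S) :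
    ∫ t in S, haarFun k t ∂volPos = 0 := by
  simp_rw [haarFun_eq]
  rw [integral_sub (integrable_indicator_dyadicIoo _ _ _ _).integrableOn
      (integrable_indicator_dyadicIoo _ _ _ _).integrableOn,
    setIntegral_indicator_dyadicIoo ((left_subset_haarSupp _ _ _).trans hS),
    setIntegral_indicator_dyadicIoo ((right_subset_haarSupp _ _ _).trans hS), sub_self]

theorem setIntegral_abs_haarFun (k : HaarIndex) {S : Set ℝ} (hS : haarSupp k ⊆ S) :
    ∫ t in S, |haarFun k t| ∂volPos = 1 := by
  simp_rw [abs_haarFun]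
  rw [integral_add (integrable_indicator_dyadicIoo _ _ _ _).integrableOn
      (integrable_indicator_dyadicIoo _ _ _ _).integrableOn,
    setIntegral_indicator_dyadicIoo ((left_subset_haarSupp _ _ _).trans hS),
    setIntegral_indicator_dyadicIoo ((right_subset_haarSupp _ _ _).trans hS)]
  field_simp
  ring

theorem integral_haarFun (k : HaarIndex) : ∫ t, haarFun k t ∂volPos = 0 := by
  simpa using setIntegral_haarFun k (subset_univ _)

theorem integral_abs_haarFun (k : HaarIndex) : ∫ t, |haarFun k t| ∂volPos = 1 := by
  simpa using setIntegral_abs_haarFun k (subset_univ _)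

theorem haarFun_eq_zero_of_ne {k : HaarIndex} {j : ℕ} (h : k.1 ≠ j) {t : ℝ}
    (ht : t ∈ Ioo (j : ℝ) (j + 1)) : haarFun k t = 0 :=
  haarFun_of_notMem fun h' =>
    notMem_haarSupp_of_ne (k' := (j, k.2)) h h' ht

theorem setIntegral_unit_haarFun (j : ℕ) (k : HaarIndex) :
    ∫ t in Ioo (j : ℝ) (j + 1), haarFun k t ∂volPos = 0 := by
  by_cases h : k.1 = j
  · exact setIntegral_haarFun k (by rw [← h]; exact haarSupp_subset k)
  · rw [setIntegral_congr_fun measurableSet_Ioo fun t ht => haarFun_eq_zero_of_ne h ht]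
    simp

theorem setIntegral_unit_abs_haarFun (j : ℕ) (k : HaarIndex) :
    ∫ t in Ioo (j : ℝ) (j + 1), |haarFun k t| ∂volPos = if k.1 = j then 1 else 0 := by
  by_cases h : k.1 = j
  · rw [if_pos h]
    exact setIntegral_abs_haarFun k (by rw [← h]; exact haarSupp_subset k)
  · rw [if_neg h, setIntegral_congr_fun (g := fun _ => (0 : ℝ)) measurableSet_Ioo fun t ht => by
      simp only [haarFun_eq_zero_of_ne h ht, abs_zero]]
    simp

theorem setIntegral_unit_unit (j m : ℕ) :
    ∫ t in Ioo (j : ℝ) (j + 1), (Ioo (m : ℝ) (m + 1)).indicator (fun _ => (1 : ℝ)) t ∂volPos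
      = if m = j then 1 else 0 := by
  by_cases h : m = j
  · subst h
    rw [if_pos rfl, ← dyadicIoo_zero, setIntegral_indicator_dyadicIoo subset_rfl]
    simp
  · rw [if_neg h, setIntegral_congr_fun (g := fun _ => (0 : ℝ)) measurableSet_Ioo fun t ht => ?_]
    · simp
    · refine indicator_of_notMem ?_ _
      rw [← dyadicIoo_zero]
      intro h'
      exact notMem_haarSupp_of_ne (k := (m, ⟨0, ⟨0, Nat.one_pos⟩⟩))
        (k' := (j, ⟨0, ⟨0, Nat.one_pos⟩⟩)) h h' ht

theorem setIntegral_unit_bumpFun (j m : ℕ) (k : HaarIndex) :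
    ∫ t in Ioo (j : ℝ) (j + 1), bumpFun m k t ∂volPos
      = 2 * (if m = j then 1 else 0) + if k.1 = j then 1 else 0 := by
  simp only [bumpFun]
  rw [integral_add, integral_const_mul, setIntegral_unit_unit, setIntegral_unit_abs_haarFun]
  · exact ((memLp_one_iff_integrable.1 (memLp_indicator_Ioo _ _ 1)).const_mul 2).integrableOn
  · exact (integrable_haarFun k).abs.integrableOn

theorem integral_bumpFun (m : ℕ) (k : HaarIndex) : ∫ t, bumpFun m k t ∂volPos = 3 := by
  simp only [bumpFun]
  rw [integral_add, integral_const_mul, integral_abs_haarFun, ← dyadicIoo_zero]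
  · have := setIntegral_indicator_dyadicIoo (subset_univ (dyadicIoo m 0 0)) 1
    rw [Measure.restrict_univ] at this
    rw [this]; norm_num
  · exact (memLp_one_iff_integrable.1 (memLp_indicator_Ioo _ _ 1)).const_mul 2
  · exact (integrable_haarFun k).abs

theorem abs_haarFun_le_bumpFun (m : ℕ) (k : HaarIndex) (t : ℝ) : |haarFun k t| ≤ bumpFun m k t := by
  have : 0 ≤ (Ioo (m : ℝ) ((m : ℝ) + 1)).indicator (fun _ => (1 : ℝ)) t :=
    indicator_nonneg (fun _ _ => zero_le_one) _
  simp only [bumpFun]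
  linarith

end Haar

/-! ### Norm estimates for the Haar functions, the blocks and the full sequence. -/

section Estimates

variable {𝕜 : Type*} [RCLike 𝕜]

theorem haarL1_coeFn (k : HaarIndex) :
    haarL1 𝕜 k =ᵐ[volPos] fun t => ((haarFun k t : ℝ) : 𝕜) := MemLp.coeFn_toLp _

theorem bumpL1_coeFn (m : ℕ) (k : HaarIndex) :
    bumpL1 𝕜 m k =ᵐ[volPos] fun t => ((bumpFun m k t : ℝ) : 𝕜) := MemLp.coeFn_toLp _

theorem norm_haarL1 (k : HaarIndex) : ‖haarL1 𝕜 k‖ = 1 := by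
  rw [L1.norm_eq_integral_norm, ← integral_abs_haarFun k]
  refine integral_congr_ae ?_
  filter_upwards [haarL1_coeFn (𝕜 := 𝕜) k] with t ht
  rw [ht, RCLike.norm_ofReal]

theorem norm_bumpL1 (m : ℕ) (k : HaarIndex) : ‖bumpL1 𝕜 m k‖ = 3 := by
  rw [L1.norm_eq_integral_norm, ← integral_bumpFun m k]
  refine integral_congr_ae ?_
  filter_upwards [bumpL1_coeFn (𝕜 := 𝕜) m k] with t ht
  rw [ht, RCLike.norm_ofReal, abs_of_nonneg ((abs_nonneg _).trans (abs_haarFun_le_bumpFun m k t))]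

/-- Adding a multiple of a Haar function to a function that is constant on its support does not
decrease the norm. -/
theorem norm_le_norm_add_smul_haarL1 {s : L1Pos 𝕜} {k : HaarIndex} {S : ℝ → 𝕜} {c : 𝕜}
    (hs : s =ᵐ[volPos] S) (hc : ∀ t ∈ haarSupp k, S t = c) (b : 𝕜) :
    ‖s‖ ≤ ‖s + b • haarL1 𝕜 k‖ := by
  -- θ is the phase that rotates c to |c|. On the support, ‖c + b h‖ ≥ Re θ(c + b h) = |c| + Re(θb)
  -- h, and the last term integrates to zero.
  obtain ⟨θ, hθ, hθc⟩ : ∃ θ : 𝕜, ‖θ‖ ≤ 1 ∧ θ * c = (‖c‖ : 𝕜) := by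
    by_cases h0 : c = 0
    · exact ⟨0, by simp, by simp [h0]⟩
    · have hn : (‖c‖ : 𝕜) ≠ 0 := by simpa using h0
      refine ⟨(‖c‖ : 𝕜) / c, by simp [h0], by field_simp⟩
  have hint : ∫ t, ‖s t‖ + RCLike.re (θ * b) * haarFun k t ∂volPos = ‖s‖ := by
    rw [integral_add (L1.integrable_coeFn s).norm ((integrable_haarFun k).const_mul _),
      integral_const_mul, integral_haarFun, mul_zero, add_zero, L1.norm_eq_integral_norm]
  rw [← hint, L1.norm_eq_integral_norm (s + b • haarL1 𝕜 k)]
  refine integral_mono_ae ((L1.integrable_coeFn s).norm.add ((integrable_haarFun k).const_mul _))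
    (L1.integrable_coeFn _).norm ?_
  filter_upwards [hs, haarL1_coeFn (𝕜 := 𝕜) k, Lp.coeFn_add s (b • haarL1 𝕜 k),
    Lp.coeFn_smul b (haarL1 𝕜 k)] with t h1 h2 h3 h4
  rw [h3, Pi.add_apply, h4, Pi.smul_apply, h2, h1, smul_eq_mul]
  by_cases ht : t ∈ haarSupp k
  · rw [hc t ht]
    calc ‖c‖ + RCLike.re (θ * b) * haarFun k t
        = RCLike.re (θ * (c + b * (haarFun k t : 𝕜))) := by
          rw [mul_add, hθc, ← mul_assoc, map_add, RCLike.ofReal_re, RCLike.re_mul_ofReal]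
      _ ≤ ‖θ * (c + b * (haarFun k t : 𝕜))‖ := RCLike.re_le_norm _
      _ ≤ ‖c + b * (haarFun k t : 𝕜)‖ := by
          rw [norm_mul]; exact mul_le_of_le_one_left (norm_nonneg _) hθ
  · simp [haarFun_of_notMem ht]

theorem haarLex_trichotomy (a b : Σ n : ℕ, Fin (2 ^ n)) : HaarLex a b ∨ a = b ∨ HaarLex b a := by
  obtain ⟨n, i⟩ := a
  obtain ⟨m, j⟩ := b
  rcases lt_trichotomy n m with h | rfl | h
  · exact Or.inl (Or.inl h)
  · rcases lt_trichotomy (i : ℕ) j with h | h | h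
    · exact Or.inl (Or.inr ⟨rfl, h⟩)
    · exact Or.inr (Or.inl (by rw [Fin.ext h]))
    · exact Or.inr (Or.inr (Or.inr ⟨rfl, h⟩))
  · exact Or.inr (Or.inr (Or.inl h))

theorem IsHaarEnum.haarLex {e : ℕ ≃ HaarIndex} (he : IsHaarEnum e) {m n : ℕ} (hmn : m < n)
    (h : (e m).1 = (e n).1) : HaarLex (e m).2 (e n).2 := by
  rcases haarLex_trichotomy (e m).2 (e n).2 with h1 | h1 | h1
  · exact h1
  · exact absurd (e.injective (Prod.ext h h1)) hmn.ne
  · exact absurd (he n m h.symm h1) hmn.not_gt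

/-- Every admissible enumeration of the Haar functions is a monotone basic sequence. -/
theorem norm_sum_haarL1_mono {e : ℕ ≃ HaarIndex} (he : IsHaarEnum e) (b : ℕ → 𝕜) :
    Monotone fun n => ‖∑ i ∈ Finset.range n, b i • haarL1 𝕜 (e i)‖ := by
  refine monotone_nat_of_le_succ fun n => ?_
  rw [Finset.sum_range_succ]
  -- Earlier functions lie on another unit interval or precede `e n` lexicographically; either way
  -- they are constant on its support.
  have hconst : ∀ i, i < n → ∃ c, ∀ t ∈ haarSupp (e n), haarFun (e i) t = c := fun i hi =>
    haarFun_const_on fun h => he.haarLex hi h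
  choose! c hc using hconst
  refine norm_le_norm_add_smul_haarL1
    (S := fun t => ∑ i ∈ Finset.range n, b i * ((haarFun (e i) t : ℝ) : 𝕜))
    (c := ∑ i ∈ Finset.range n, b i * ((c i : ℝ) : 𝕜)) ?_ (fun t ht => ?_) _
  · clear hc
    induction n with
    | zero => exact Lp.coeFn_zero 𝕜 1 volPos
    | succ n ih =>
      rw [Finset.sum_range_succ]
      filter_upwards [ih, Lp.coeFn_add (∑ i ∈ Finset.range n, b i • haarL1 𝕜 (e i))
        (b n • haarL1 𝕜 (e n)), Lp.coeFn_smul (b n) (haarL1 𝕜 (e n)),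
        haarL1_coeFn (𝕜 := 𝕜) (e n)] with t h1 h2 h3 h4
      rw [h2, Pi.add_apply, h1, h3, Pi.smul_apply, h4, Finset.sum_range_succ, smul_eq_mul]
  · exact Finset.sum_congr rfl fun i hi => by rw [hc i (Finset.mem_range.1 hi) t ht]

/-- The integral over the unit interval `(j, j + 1)`. -/
noncomputable def unitIntegral (𝕜 : Type*) [RCLike 𝕜] (j : ℕ) : L1Pos 𝕜 →ₗ[𝕜] 𝕜 where
  toFun f := ∫ t in Ioo (j : ℝ) (j + 1), f t ∂volPos
  map_add' f g := by
    rw [← integral_add (L1.integrable_coeFn f).integrableOn (L1.integrable_coeFn g).integrableOn]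
    exact integral_congr_ae (ae_restrict_of_ae (Lp.coeFn_add f g))
  map_smul' c f := by
    rw [RingHom.id_apply, ← integral_smul]
    exact integral_congr_ae (ae_restrict_of_ae (Lp.coeFn_smul c f))

theorem unitIntegral_haarL1 (j : ℕ) (k : HaarIndex) : unitIntegral 𝕜 j (haarL1 𝕜 k) = 0 := by
  change ∫ t in Ioo (j : ℝ) (j + 1), haarL1 𝕜 k t ∂volPos = 0
  rw [integral_congr_ae (ae_restrict_of_ae (haarL1_coeFn k)), integral_ofReal,
    setIntegral_unit_haarFun, RCLike.ofReal_zero]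

theorem unitIntegral_bumpL1 (j m : ℕ) (k : HaarIndex) : unitIntegral 𝕜 j (bumpL1 𝕜 m k)
    = 2 * (if m = j then 1 else 0) + if k.1 = j then 1 else 0 := by
  change ∫ t in Ioo (j : ℝ) (j + 1), bumpL1 𝕜 m k t ∂volPos = _
  rw [integral_congr_ae (ae_restrict_of_ae (bumpL1_coeFn m k)), integral_ofReal,
    setIntegral_unit_bumpFun]
  push_cast
  split_ifs <;> simp

theorem sum_norm_unitIntegral_le (S : Finset ℕ) (u : L1Pos 𝕜) :
    ∑ j ∈ S, ‖unitIntegral 𝕜 j u‖ ≤ ‖u‖ := by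
  have hd : Set.Pairwise (S : Set ℕ)
      (Function.onFun Disjoint fun j : ℕ => Ioo (j : ℝ) (j + 1)) := by
    intro i _ j _ hij
    refine Set.disjoint_left.2 fun t h1 h2 => hij ?_
    have h3 : (i : ℝ) < j + 1 := h1.1.trans h2.2
    have h4 : (j : ℝ) < i + 1 := h2.1.trans h1.2
    have h5 : i < j + 1 := by exact_mod_cast h3
    have h6 : j < i + 1 := by exact_mod_cast h4
    omega
  calc ∑ j ∈ S, ‖unitIntegral 𝕜 j u‖
      ≤ ∑ j ∈ S, ∫ t in Ioo (j : ℝ) (j + 1), ‖u t‖ ∂volPos :=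
        Finset.sum_le_sum fun j _ => norm_integral_le_integral_norm _
    _ = ∫ t in ⋃ j ∈ S, Ioo (j : ℝ) (j + 1), ‖u t‖ ∂volPos :=
        (integral_biUnion_finset S (fun _ _ => measurableSet_Ioo) hd
          fun _ _ => (L1.integrable_coeFn u).norm.integrableOn).symm
    _ ≤ ‖u‖ := by
        rw [L1.norm_eq_integral_norm]
        exact setIntegral_le_integral (L1.integrable_coeFn u).norm
          (Eventually.of_forall fun _ => norm_nonneg _)

variable (e : ℕ ≃ HaarIndex) (π : Equiv.Perm ℕ)

/-- The coefficients of the bumps are dominated in `ℓ₁` by the norm. -/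
theorem sum_norm_le_norm_sum (a b : ℕ → 𝕜) (m : ℕ) :
    ∑ i ∈ Finset.range m, ‖a i‖
      ≤ ‖∑ i ∈ Finset.range m, (a i • bumpL1 𝕜 (π i) (e i) + b i • haarL1 𝕜 (e i))‖ := by
  set u := ∑ i ∈ Finset.range m, (a i • bumpL1 𝕜 (π i) (e i) + b i • haarL1 𝕜 (e i)) with hu
  -- Integration over the unit interval `π p` isolates `2 * a p`, up to the bumps whose |h_i| part,
  -- of integral 1, sits on that interval.
  have h1 : ∀ p ∈ Finset.range m, 2 * ‖a p‖ ≤ ‖unitIntegral 𝕜 (π p) u‖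
      + ∑ i ∈ Finset.range m, if (e i).1 = π p then ‖a i‖ else 0 := by
    intro p hp
    have h2 : unitIntegral 𝕜 (π p) u
        = 2 * a p + ∑ i ∈ Finset.range m, if (e i).1 = π p then a i else 0 := by
      rw [hu, map_sum]
      simp only [map_add, map_smul, unitIntegral_haarL1, unitIntegral_bumpL1, smul_eq_mul,
        mul_zero, add_zero, mul_add, Finset.sum_add_distrib, mul_ite, mul_one,
        EmbeddingLike.apply_eq_iff_eq, Finset.sum_ite_eq', hp, if_true]
      ring
    have h3 : ‖∑ i ∈ Finset.range m, if (e i).1 = π p then a i else 0‖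
        ≤ ∑ i ∈ Finset.range m, if (e i).1 = π p then ‖a i‖ else 0 := by
      refine (norm_sum_le _ _).trans (le_of_eq (Finset.sum_congr rfl fun i _ => ?_))
      split_ifs <;> simp
    have h4 : 2 * a p = unitIntegral 𝕜 (π p) u
        - ∑ i ∈ Finset.range m, if (e i).1 = π p then a i else 0 := by rw [h2]; ring
    calc 2 * ‖a p‖ = ‖2 * a p‖ := by simp
      _ ≤ _ := by rw [h4]; exact (norm_sub_le _ _).trans (add_le_add le_rfl h3)
  have h5 := Finset.sum_le_sum h1
  rw [Finset.sum_add_distrib, ← Finset.mul_sum, Finset.sum_comm] at h5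
  have h6 : ∑ p ∈ Finset.range m, ‖unitIntegral 𝕜 (π p) u‖ ≤ ‖u‖ := by
    have := sum_norm_unitIntegral_le ((Finset.range m).map π.toEmbedding) u
    rwa [Finset.sum_map] at this
  -- For given i at most one p satisfies `π p = (e i).1`, so each ‖a i‖ is charged at most once and
  -- can be absorbed by the factor 2.
  have h7 : ∑ i ∈ Finset.range m, ∑ p ∈ Finset.range m, (if (e i).1 = π p then ‖a i‖ else 0)
      ≤ ∑ i ∈ Finset.range m, ‖a i‖ := by
    refine Finset.sum_le_sum fun i _ => ?_
    have : ∀ p, ((e i).1 = π p) = (π.symm (e i).1 = p) := fun p => by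
      rw [Equiv.symm_apply_eq]
    simp_rw [this]
    rw [Finset.sum_ite_eq]
    split_ifs
    · exact le_rfl
    · exact norm_nonneg _
  linarith

/-- The Haar part is the whole sum minus the bump part. Bumps have norm 3, so the bump part costs 3
and the constant is 1 + 3. -/
theorem norm_sum_haarL1_le (a b : ℕ → 𝕜) (m : ℕ) :
    ‖∑ i ∈ Finset.range m, b i • haarL1 𝕜 (e i)‖
      ≤ 4 * ‖∑ i ∈ Finset.range m, (a i • bumpL1 𝕜 (π i) (e i) + b i • haarL1 𝕜 (e i))‖ := by
  have h1 := sum_norm_le_norm_sum e π a b m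
  have h2 : ‖∑ i ∈ Finset.range m, a i • bumpL1 𝕜 (π i) (e i)‖
      ≤ 3 * ∑ i ∈ Finset.range m, ‖a i‖ := by
    refine (norm_sum_le _ _).trans (le_of_eq ?_)
    rw [Finset.mul_sum]
    exact Finset.sum_congr rfl fun i _ => by rw [norm_smul, norm_bumpL1, mul_comm]
  have h3 : ∑ i ∈ Finset.range m, b i • haarL1 𝕜 (e i)
      = ∑ i ∈ Finset.range m, (a i • bumpL1 𝕜 (π i) (e i) + b i • haarL1 𝕜 (e i))
        - ∑ i ∈ Finset.range m, a i • bumpL1 𝕜 (π i) (e i) := by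
    rw [Finset.sum_add_distrib]; abel
  rw [h3] at *
  linarith [norm_sub_le (∑ i ∈ Finset.range m, (a i • bumpL1 𝕜 (π i) (e i) + b i • haarL1 𝕜 (e i)))
    (∑ i ∈ Finset.range m, a i • bumpL1 𝕜 (π i) (e i))]

variable {e}

/-- The bump part of the shorter sum costs 3 by the ℓ₁ bound, and the Haar part costs 4 by
monotonicity; 7 = 3 + 4. -/
theorem norm_sum_block_le (he : IsHaarEnum e) (a b : ℕ → 𝕜) {n m : ℕ} (hnm : n ≤ m) :
    ‖∑ i ∈ Finset.range n, (a i • bumpL1 𝕜 (π i) (e i) + b i • haarL1 𝕜 (e i))‖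
      ≤ 7 * ‖∑ i ∈ Finset.range m, (a i • bumpL1 𝕜 (π i) (e i) + b i • haarL1 𝕜 (e i))‖ := by
  have h1 := sum_norm_le_norm_sum e π a b m
  have h2 := norm_sum_haarL1_le e π a b m
  have h3 : ‖∑ i ∈ Finset.range n, a i • bumpL1 𝕜 (π i) (e i)‖
      ≤ 3 * ∑ i ∈ Finset.range m, ‖a i‖ := by
    refine (norm_sum_le _ _).trans ?_
    rw [Finset.mul_sum]
    calc ∑ i ∈ Finset.range n, ‖a i • bumpL1 𝕜 (π i) (e i)‖
        = ∑ i ∈ Finset.range n, 3 * ‖a i‖ :=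
          Finset.sum_congr rfl fun i _ => by rw [norm_smul, norm_bumpL1, mul_comm]
      _ ≤ _ := Finset.sum_le_sum_of_subset_of_nonneg (Finset.range_mono hnm)
          fun i _ _ => by positivity
  have h4 := norm_sum_haarL1_mono he b hnm
  simp only at h4
  rw [Finset.sum_add_distrib]
  linarith [norm_add_le (∑ i ∈ Finset.range n, a i • bumpL1 𝕜 (π i) (e i))
    (∑ i ∈ Finset.range n, b i • haarL1 𝕜 (e i))]

theorem sum_blockSeq_even (c : ℕ → 𝕜) (n : ℕ) :
    ∑ k ∈ Finset.range (2 * n), c k • blockSeq 𝕜 e π k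
      = ∑ i ∈ Finset.range n, ((c (2 * i) + c (2 * i + 1)) • bumpL1 𝕜 (π i) (e i)
        + (c (2 * i) - c (2 * i + 1)) • haarL1 𝕜 (e i)) := by
  induction n with
  | zero => simp
  | succ n ih =>
    rw [show 2 * (n + 1) = 2 * n + 1 + 1 by ring, Finset.sum_range_succ, Finset.sum_range_succ,
      ih, Finset.sum_range_succ, add_assoc]
    congr 1
    simp only [blockSeq, show 2 * n % 2 = 0 by omega, show (2 * n + 1) % 2 = 1 by omega,
      show 2 * n / 2 = n by omega, show (2 * n + 1) / 2 = n by omega, if_true, one_ne_zero,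
      if_false, blockX, blockY, smul_add, smul_sub, add_smul, sub_smul]
    abel

/-- Cutting between blocks costs 7. Cutting inside a block adds one term c x_p with |c| ≤ (|a_p| +
|b_p|)/2 ≤ (1 + 8)/2 times the norm and ‖x_p‖ ≤ 4; 25 = 7 + 18. -/
theorem norm_sum_blockSeq_le_even (he : IsHaarEnum e) (c : ℕ → 𝕜) {n m : ℕ} (hnm : n ≤ 2 * m) :
    ‖∑ k ∈ Finset.range n, c k • blockSeq 𝕜 e π k‖
      ≤ 25 * ‖∑ k ∈ Finset.range (2 * m), c k • blockSeq 𝕜 e π k‖ := by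
  set a : ℕ → 𝕜 := fun i => c (2 * i) + c (2 * i + 1)
  set b : ℕ → 𝕜 := fun i => c (2 * i) - c (2 * i + 1)
  have heven := fun n => sum_blockSeq_even (e := e) π c n
  obtain ⟨p, rfl | rfl⟩ : ∃ p, n = 2 * p ∨ n = 2 * p + 1 := ⟨n / 2, by omega⟩
  · rw [heven, heven]
    have := norm_sum_block_le π he a b (show p ≤ m by omega)
    exact this.trans (mul_le_mul_of_nonneg_right (by norm_num) (norm_nonneg _))
  · rw [Finset.sum_range_succ, heven, heven]
    have hpm : p + 1 ≤ m := by omega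
    have h1 := norm_sum_block_le π he a b (show p ≤ m by omega)
    have h2 := sum_norm_le_norm_sum e π a b m
    have h3 := norm_sum_haarL1_le e π a b m
    have h4 := norm_sum_haarL1_mono he b hpm
    have h5 := norm_sum_haarL1_mono he b ((Nat.le_succ p).trans hpm)
    set N := ‖∑ i ∈ Finset.range m, (a i • bumpL1 𝕜 (π i) (e i) + b i • haarL1 𝕜 (e i))‖
    have h6 : ‖a p‖ ≤ N := (Finset.single_le_sum (f := fun i => ‖a i‖)
      (fun i _ => norm_nonneg _) (Finset.mem_range.2 (show p < m by omega))).trans h2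
    have h7 : ‖b p‖ ≤ 8 * N := by
      have e1 : b p • haarL1 𝕜 (e p) = ∑ i ∈ Finset.range (p + 1), b i • haarL1 𝕜 (e i)
          - ∑ i ∈ Finset.range p, b i • haarL1 𝕜 (e i) := by rw [Finset.sum_range_succ]; abel
      have e2 : ‖b p‖ = ‖b p • haarL1 𝕜 (e p)‖ := by rw [norm_smul, norm_haarL1, mul_one]
      rw [e2, e1]
      refine (norm_sub_le _ _).trans ?_
      simp only at h4 h5
      linarith
    have h8 : ‖c (2 * p)‖ ≤ 9 / 2 * N := by
      have e1 : 2 * c (2 * p) = a p + b p := by simp only [a, b]; ring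
      have e2 : 2 * ‖c (2 * p)‖ ≤ ‖a p‖ + ‖b p‖ := by
        calc 2 * ‖c (2 * p)‖ = ‖2 * c (2 * p)‖ := by simp
          _ ≤ _ := by rw [e1]; exact norm_add_le _ _
      linarith
    have h9 : ‖blockSeq 𝕜 e π (2 * p)‖ ≤ 4 := by
      simp only [blockSeq, show 2 * p % 2 = 0 by omega, show 2 * p / 2 = p by omega, if_true,
        blockX]
      refine (norm_add_le _ _).trans ?_
      rw [norm_bumpL1, norm_haarL1]; norm_num
    have h10 : ‖c (2 * p) • blockSeq 𝕜 e π (2 * p)‖ ≤ 9 / 2 * N * 4 := by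
      rw [norm_smul]
      exact mul_le_mul h8 h9 (norm_nonneg _) ((norm_nonneg _).trans h8)
    refine (norm_add_le _ _).trans ?_
    change _ + _ ≤ 25 * N
    linarith

/-- The sequence `x_0, y_0, x_1, y_1, …` is basic, with a universal constant. -/
theorem norm_sum_blockSeq_le (he : IsHaarEnum e) (c : ℕ → 𝕜) {n m : ℕ} (hnm : n ≤ m) :
    ‖∑ k ∈ Finset.range n, c k • blockSeq 𝕜 e π k‖
      ≤ 25 * ‖∑ k ∈ Finset.range m, c k • blockSeq 𝕜 e π k‖ := by
  -- Coefficients from m on are set to zero, so that the sum of length m equals one of even length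
  -- 2m.
  have h := norm_sum_blockSeq_le_even π he (fun k => if k < m then c k else 0)
    (show n ≤ 2 * m by omega)
  have e1 : ∀ p, p ≤ m → ∑ k ∈ Finset.range p, (if k < m then c k else 0) • blockSeq 𝕜 e π k
      = ∑ k ∈ Finset.range p, c k • blockSeq 𝕜 e π k := fun p hp =>
    Finset.sum_congr rfl fun k hk => by
      rw [if_pos ((Finset.mem_range.1 hk).trans_le hp)]
  have e2 : ∑ k ∈ Finset.range (2 * m), (if k < m then c k else 0) • blockSeq 𝕜 e π k
      = ∑ k ∈ Finset.range m, c k • blockSeq 𝕜 e π k := by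
    rw [← e1 m le_rfl]
    refine (Finset.sum_subset (Finset.range_mono (by omega)) fun k _ hk => ?_).symm
    rw [if_neg (by simpa using hk), zero_smul]
  rwa [e1 n hnm, e2] at h

end Estimates

/-! ### Density of the span for suitable permutations. -/

section Density

variable {𝕜 : Type*} [RCLike 𝕜] {Z : Submodule 𝕜 (L1Pos 𝕜)}

/-- Only the midpoint is missed by both open halves. -/
theorem ae_haarSupp (k : HaarIndex) (μ : Measure ℝ) [NullSingletonClass μ] :
    ∀ᵐ t ∂μ, t ∈ haarSupp k → t ∈ dyadicIoo k.1 (k.2.1 + 1) (2 * k.2.2) ∨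
      t ∈ dyadicIoo k.1 (k.2.1 + 1) (2 * k.2.2 + 1) := by
  have h0 : ∀ᵐ t ∂μ, t ≠ (k.1 : ℝ) + (2 * (k.2.2 : ℕ) + 1) / 2 ^ (k.2.1 + 1) := by
    rw [ae_iff]; simp
  filter_upwards [h0] with t ht hs
  rw [haarSupp, mem_dyadicIoo] at hs
  rw [mem_dyadicIoo, mem_dyadicIoo, pow_succ]
  have hne : (2 : ℝ) ^ k.2.1 * 2 * (t - k.1) ≠ 2 * (k.2.2 : ℕ) + 1 := fun h => ht (by
    rw [pow_succ, ← h]; field_simp; ring)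
  push_cast
  rcases lt_or_gt_of_ne hne with h | h
  · left; constructor <;> linarith [hs.1]
  · right; constructor <;> linarith [hs.2]

/-- Halving: a subspace that contains the indicator of a dyadic interval and its Haar function
contains the indicators of both halves. -/
theorem ContainsIndicator.halves {k : HaarIndex} (hk : ContainsIndicator Z (haarSupp k))
    (hh : haarL1 𝕜 k ∈ Z) :
    ContainsIndicator Z (dyadicIoo k.1 (k.2.1 + 1) (2 * k.2.2)) ∧
      ContainsIndicator Z (dyadicIoo k.1 (k.2.1 + 1) (2 * k.2.2 + 1)) := by
  obtain ⟨h1, h2, h3⟩ := hk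
  have hp : ((2 : ℝ) ^ k.2.1) ≠ 0 := by positivity
  set c : 𝕜 := RCLike.ofReal ((2 : ℝ) ^ k.2.1)⁻¹ with hc
  have hleft : ContainsIndicator Z (dyadicIoo k.1 (k.2.1 + 1) (2 * k.2.2)) := by
    -- The left half has indicator (1_I + 2⁻ⁿ h)/2, since 2⁻ⁿ h is 1 on the left half and −1 on the
    -- right one.
    refine .of_mem (Z.smul_mem (2⁻¹ : 𝕜) (Z.add_mem h3 (Z.smul_mem c hh)))
      (measurableSet_dyadicIoo _ _ _) (volPos_dyadicIoo_ne_top _ _ _) ?_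
    filter_upwards [Lp.coeFn_smul (2⁻¹ : 𝕜) (indicatorConstLp 1 h1 h2 (1 : 𝕜) + c • haarL1 𝕜 k),
      Lp.coeFn_add (indicatorConstLp 1 h1 h2 (1 : 𝕜)) (c • haarL1 𝕜 k),
      Lp.coeFn_smul c (haarL1 𝕜 k), haarL1_coeFn (𝕜 := 𝕜) k,
      indicatorConstLp_coeFn (p := 1) (hs := h1) (hμs := h2) (c := (1 : 𝕜)),
      ae_haarSupp k volPos] with t e1 e2 e3 e4 e5 e6
    rw [e1, Pi.smul_apply, e2, Pi.add_apply, e3, Pi.smul_apply, e4, e5, haarFun_eq]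
    by_cases ht : t ∈ dyadicIoo k.1 (k.2.1 + 1) (2 * k.2.2)
    · have ht' := notMem_of_mem_dyadicIoo (Nat.succ_ne_self _).symm ht
      have ht'' : t ∈ haarSupp k := left_subset_haarSupp _ _ _ ht
      simp only [indicator_of_mem ht, indicator_of_mem ht'', indicator_of_notMem ht', sub_zero, hc,
        smul_eq_mul, ← RCLike.ofReal_mul, inv_mul_cancel₀ hp, RCLike.ofReal_one]
      norm_num
    · by_cases hs : t ∈ haarSupp k
      · have ht' := (e6 hs).resolve_left ht
        simp only [indicator_of_mem hs, indicator_of_mem ht', indicator_of_notMem ht, zero_sub, hc,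
          smul_eq_mul, ← RCLike.ofReal_mul, mul_neg, inv_mul_cancel₀ hp, RCLike.ofReal_one,
          RCLike.ofReal_neg]
        norm_num
      · have ht' : t ∉ dyadicIoo k.1 (k.2.1 + 1) (2 * k.2.2 + 1) :=
          fun h => hs (right_subset_haarSupp _ _ _ h)
        simp [hs, ht, ht']
  refine ⟨hleft, ?_⟩
  have hd := hleft.diff ⟨h1, h2, h3⟩ (left_subset_haarSupp _ _ _)
  refine hd.congr_ae (measurableSet_dyadicIoo _ _ _) ?_
  filter_upwards [ae_haarSupp k volPos] with t e6
  refine propext ⟨fun h => (e6 h.1).resolve_left h.2, fun h =>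
    ⟨right_subset_haarSupp _ _ _ h, notMem_of_mem_dyadicIoo (Nat.succ_ne_self _) h⟩⟩

theorem containsIndicator_dyadicIoo (hh : ∀ k, haarL1 𝕜 k ∈ Z) {j : ℕ}
    (hj : ContainsIndicator Z (dyadicIoo j 0 0)) (n i : ℕ) (hi : i < 2 ^ n) :
    ContainsIndicator Z (dyadicIoo j n i) := by
  induction n generalizing i with
  | zero =>
    have : i = 0 := by simpa using hi
    rw [this]; exact hj
  | succ n ih =>
    have h2 : i / 2 < 2 ^ n := by rw [pow_succ] at hi; omega
    have h3 := ContainsIndicator.halves (k := (j, ⟨n, ⟨i / 2, h2⟩⟩)) (ih _ h2) (hh _)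
    rcases Nat.mod_two_eq_zero_or_one i with h | h
    · have : 2 * (i / 2) = i := by omega
      have h4 := h3.1
      simp only [this] at h4
      exact h4
    · have : 2 * (i / 2) + 1 = i := by omega
      have h4 := h3.2
      simp only [this] at h4
      exact h4

/-- A closed subspace of `L₁(0, ∞)` that contains all dyadic indicators is everything. -/
theorem eq_top_of_containsIndicator_dyadicIoo (hZ : IsClosed (Z : Set (L1Pos 𝕜)))
    (h : ∀ j n i, i < 2 ^ n → ContainsIndicator Z (dyadicIoo j n i)) : Z = ⊤ := by
  have hfin : ∀ a b : ℝ, volPos (Ioc a b) ≠ ∞ := fun a b =>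
    ((Measure.restrict_apply_le _ _).trans_lt (by simp)).ne
  have h1 : ∀ n i : ℕ, ContainsIndicator Z (Ioc 0 ((i : ℝ) / 2 ^ n)) := fun n i => by
    have hp : (0 : ℝ) < 2 ^ n := by positivity
    induction i with
    | zero => simpa using ContainsIndicator.empty
    | succ i ih =>
      -- Quotient and remainder of i by 2 ^ n give the unit interval and the position of the next
      -- dyadic interval to be appended.
      have h2 := (h (i / 2 ^ n) n (i % 2 ^ n) (Nat.mod_lt _ (by positivity))).congr_ae
        measurableSet_Ioc Ioo_ae_eq_Ioc
      have e : ((i / 2 ^ n : ℕ) : ℝ) + ((i % 2 ^ n : ℕ) : ℝ) / 2 ^ n = i / 2 ^ n := by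
        have : ((2 ^ n * (i / 2 ^ n) + i % 2 ^ n : ℕ) : ℝ) = i := by rw [Nat.div_add_mod]
        rw [eq_div_iff hp.ne', add_mul, div_mul_cancel₀ _ hp.ne']
        push_cast at this
        linarith
      rw [add_div, ← add_assoc, e] at h2
      have h3 := ih.union h2 (Set.disjoint_left.2 fun t h1 h2 => not_lt.2 h1.2 h2.1)
      rw [Ioc_union_Ioc_eq_Ioc (by positivity) (by linarith [div_pos one_pos hp])] at h3
      rwa [Nat.cast_succ, add_div]
  have h2 : ∀ x : ℝ, 0 ≤ x → ContainsIndicator Z (Ioc 0 x) := fun x hx => by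
    refine ContainsIndicator.of_tendsto hZ (fun n => h1 n ⌊2 ^ n * x⌋₊) measurableSet_Ioc
      (hfin _ _) ?_
    have hle : ∀ n : ℕ, (⌊2 ^ n * x⌋₊ : ℝ) / 2 ^ n ≤ x := fun n => by
      rw [div_le_iff₀ (by positivity), mul_comm x]
      exact Nat.floor_le (by positivity)
    have hlt : ∀ n : ℕ, x - (⌊2 ^ n * x⌋₊ : ℝ) / 2 ^ n ≤ (2⁻¹ : ℝ) ^ n := fun n => by
      have hp : (0 : ℝ) < 2 ^ n := by positivity
      have := (Nat.lt_floor_add_one (2 ^ n * x)).le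
      rw [inv_pow, sub_le_iff_le_add, inv_eq_one_div, ← add_div, le_div_iff₀ hp]
      linarith
    have hle' : ∀ n : ℕ, volPos (symmDiff (Ioc 0 ((⌊2 ^ n * x⌋₊ : ℝ) / 2 ^ n)) (Ioc 0 x))
        ≤ ENNReal.ofReal ((2⁻¹ : ℝ) ^ n) := fun n => by
      rw [symmDiff_of_le (Ioc_subset_Ioc_right (hle n))]
      refine (Measure.restrict_apply_le _ _).trans ?_
      refine (measure_mono (t := Ioc ((⌊2 ^ n * x⌋₊ : ℝ) / 2 ^ n) x) fun t ht => ?_).trans ?_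
      · refine ⟨?_, ht.1.2⟩
        by_contra hc
        exact ht.2 ⟨ht.1.1, not_lt.1 hc⟩
      · rw [Real.volume_Ioc]
        exact ENNReal.ofReal_le_ofReal (hlt n)
    refine tendsto_of_tendsto_of_tendsto_of_le_of_le tendsto_const_nhds ?_ (fun _ => zero_le) hle'
    have := ENNReal.tendsto_ofReal
      (tendsto_pow_atTop_nhds_zero_of_lt_one (r := (2⁻¹ : ℝ)) (by norm_num) (by norm_num))
    simpa using this
  refine eq_top_of_containsIndicator_Iic (A := fun N : ℕ => Ioc (0 : ℝ) N) hZ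
    (fun N M h => Ioc_subset_Ioc_right (by exact_mod_cast h)) ?_ (fun N => h2 _ (by positivity))
    fun N x => ?_
  · have : (⋃ N : ℕ, Ioc (0 : ℝ) N) = Ioi 0 := by
      ext t
      simp only [mem_iUnion, mem_Ioc, mem_Ioi]
      exact ⟨fun ⟨_, h⟩ => h.1, fun h => ⟨⌈t⌉₊, h, Nat.le_ceil t⟩⟩
    rw [this, Measure.restrict_apply measurableSet_Ioi.compl, compl_inter_self, measure_empty]
  · rcases lt_or_ge x 0 with hx | hx
    · have : Iic x ∩ Ioc (0 : ℝ) N = ∅ := by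
        ext t; simp only [mem_inter_iff, mem_Iic, mem_Ioc, mem_empty_iff_false, iff_false]
        intro h'; linarith [h'.1, h'.2.1]
      rw [this]; exact .empty
    · have : Iic x ∩ Ioc (0 : ℝ) N = Ioc 0 (min x N) := by
        ext t; simp only [mem_inter_iff, mem_Iic, mem_Ioc, le_min_iff]; tauto
      rw [this]; exact h2 _ (by positivity)

theorem abs_haarFun_ae (k : HaarIndex) (μ : Measure ℝ) [NullSingletonClass μ] :
    ∀ᵐ t ∂μ, |haarFun k t| = 2 ^ k.2.1 * (haarSupp k).indicator (fun _ => (1 : ℝ)) t := by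
  filter_upwards [ae_haarSupp k μ] with t h
  by_cases hs : t ∈ haarSupp k
  · rw [abs_haarFun, indicator_of_mem hs]
    rcases h hs with h | h
    · rw [indicator_of_mem h,
        indicator_of_notMem (notMem_of_mem_dyadicIoo (Nat.succ_ne_self _).symm h)]
      simp
    · rw [indicator_of_mem h,
        indicator_of_notMem (notMem_of_mem_dyadicIoo (Nat.succ_ne_self _) h)]
      simp
  · rw [haarFun_of_notMem hs, indicator_of_notMem hs]; simp

variable {e : ℕ ≃ HaarIndex} {π : Equiv.Perm ℕ}

/-- For a suitable permutation the blocks span `L₁(0, ∞)`. -/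
theorem eq_top_of_bumpL1_mem (he : StartsAtFirst e) (hπ : IsSuitablePerm e π)
    (hZ : IsClosed (Z : Set (L1Pos 𝕜))) (hg : ∀ i, bumpL1 𝕜 (π i) (e i) ∈ Z)
    (hh : ∀ i, haarL1 𝕜 (e i) ∈ Z) : Z = ⊤ := by
  have hh' : ∀ k, haarL1 𝕜 k ∈ Z := fun k => by simpa using hh (e.symm k)
  refine eq_top_of_containsIndicator_dyadicIoo hZ fun j n i hi =>
    containsIndicator_dyadicIoo hh' ?_ n i hi
  clear hi n i
  -- Once the unit interval j is reached, halving gives all dyadic intervals in it, and these serve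
  -- to strip |h_i| from bumps placed further right.
  induction j using Nat.strong_induction_on with
  | _ j ih =>
    obtain ⟨i, rfl⟩ := π.surjective j
    by_cases hi : i = 0
    · subst hi
      rw [hπ.1]
      have h1 := hg 0
      rw [hπ.1, he] at h1
      -- Here bump and Haar function share the interval (0,1), so the bump is 2 + 1 = 3 times its
      -- indicator almost everywhere.
      refine .of_mem (Z.smul_mem (3⁻¹ : 𝕜) h1) (measurableSet_dyadicIoo _ _ _)
        (volPos_dyadicIoo_ne_top _ _ _) ?_
      filter_upwards [Lp.coeFn_smul (3⁻¹ : 𝕜) (bumpL1 𝕜 0 (0, ⟨0, ⟨0, Nat.one_pos⟩⟩)),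
        bumpL1_coeFn (𝕜 := 𝕜) 0 (0, ⟨0, ⟨0, Nat.one_pos⟩⟩),
        abs_haarFun_ae (0, ⟨0, ⟨0, Nat.one_pos⟩⟩) volPos] with t e1 e2 e3
      rw [e1, Pi.smul_apply, e2]
      simp only [bumpFun, e3, haarSupp, ← dyadicIoo_zero]
      by_cases ht : t ∈ dyadicIoo 0 0 0
      · simp only [indicator_of_mem ht]
        push_cast
        simp only [smul_eq_mul]
        norm_num
      · simp [ht]
    · have hlt := hπ.2 i (Nat.pos_of_ne_zero hi)
      obtain ⟨h1, h2, h3⟩ := containsIndicator_dyadicIoo hh' (ih _ hlt) _ _ (e i).2.2.2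
      set c : 𝕜 := 2 ^ (e i).2.1 with hc
      -- Almost everywhere |h_i| is 2ⁿ times the indicator of a dyadic interval in the unit interval
      -- `(e i).1 < π i`, already available by induction.
      refine .of_mem (Z.smul_mem (2⁻¹ : 𝕜) (Z.sub_mem (hg i) (Z.smul_mem c h3)))
        (measurableSet_dyadicIoo _ _ _) (volPos_dyadicIoo_ne_top _ _ _) ?_
      filter_upwards [Lp.coeFn_smul (2⁻¹ : 𝕜)
          (bumpL1 𝕜 (π i) (e i) - c • indicatorConstLp 1 h1 h2 (1 : 𝕜)),
        Lp.coeFn_sub (bumpL1 𝕜 (π i) (e i)) (c • indicatorConstLp 1 h1 h2 (1 : 𝕜)),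
        Lp.coeFn_smul c (indicatorConstLp 1 h1 h2 (1 : 𝕜)),
        bumpL1_coeFn (𝕜 := 𝕜) (π i) (e i), abs_haarFun_ae (e i) volPos,
        indicatorConstLp_coeFn (p := 1) (hs := h1) (hμs := h2) (c := (1 : 𝕜))]
        with t e1 e2 e3 e4 e5 e6
      rw [e1, Pi.smul_apply, e2, Pi.sub_apply, e3, Pi.smul_apply, e4, e6]
      simp only [bumpFun, e5, ← dyadicIoo_zero, haarSupp]
      push_cast
      by_cases ht : t ∈ dyadicIoo (e i).1 (e i).2.1 (e i).2.2 <;>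
        by_cases ht' : t ∈ dyadicIoo (π i) 0 0 <;>
        simp [ht, ht', hc]

end Density

/-! ### Existence of admissible enumerations and suitable permutations. -/

section Enumerations

/-- The lexicographic enumeration of the Haar indices on one unit interval. -/
def haarRank (a : Σ n : ℕ, Fin (2 ^ n)) : ℕ := 2 ^ a.1 + a.2 - 1

theorem haarRank_lt_of_haarLex {a b : Σ n : ℕ, Fin (2 ^ n)} (h : HaarLex a b) :
    haarRank a < haarRank b := by
  have ha := a.2.2
  have hp : 0 < 2 ^ a.1 := by positivity
  simp only [haarRank]
  rcases h with h | ⟨h, h'⟩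
  · have : 2 ^ (a.1 + 1) ≤ 2 ^ b.1 := Nat.pow_le_pow_right (by norm_num) h
    rw [pow_succ] at this
    omega
  · have : 2 ^ a.1 = 2 ^ b.1 := by rw [h]
    omega

theorem haarRank_bijective : Function.Bijective haarRank := by
  refine ⟨fun a b hab => ?_, fun m => ?_⟩
  · rcases haarLex_trichotomy a b with h | h | h
    · exact absurd hab (haarRank_lt_of_haarLex h).ne
    · exact h
    · exact absurd hab (haarRank_lt_of_haarLex h).ne'
  · have h1 := Nat.pow_log_le_self 2 (Nat.succ_ne_zero m)
    have h2 := Nat.lt_pow_succ_log_self (b := 2) (by norm_num) (m + 1)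
    rw [pow_succ] at h2
    -- Level n occupies the ranks from 2ⁿ − 1 to 2ⁿ⁺¹ − 2, so the level of rank m is the binary
    -- logarithm of m + 1.
    refine ⟨⟨Nat.log 2 (m + 1), ⟨m + 1 - 2 ^ Nat.log 2 (m + 1), ?_⟩⟩, ?_⟩
    · omega
    · simp only [haarRank]
      simp only [Nat.succ_eq_add_one] at h1
      omega

theorem exists_isHaarEnum : ∃ e : ℕ ≃ HaarIndex, IsHaarEnum e ∧ StartsAtFirst e := by
  let r := Equiv.ofBijective haarRank haarRank_bijective
  let e : HaarIndex ≃ ℕ := (Equiv.prodCongr (Equiv.refl ℕ) r).trans Nat.pairEquiv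
  have he : ∀ k, e k = Nat.pair k.1 (haarRank k.2) := fun k => rfl
  refine ⟨e.symm, fun m n h1 h2 => ?_, ?_⟩
  · obtain ⟨k, rfl⟩ := e.surjective m
    obtain ⟨k', rfl⟩ := e.surjective n
    rw [Equiv.symm_apply_apply, Equiv.symm_apply_apply] at h1 h2
    rw [he, he, h1]
    exact Nat.pair_lt_pair_right _ (haarRank_lt_of_haarLex h2)
  · rw [StartsAtFirst, Equiv.symm_apply_eq, he]
    simp [haarRank, Nat.pair]

/-- An injection of a set with infinite complement, such that the image has infinite complement,
extends to a permutation. -/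
theorem exists_perm_extending {t : ℕ → ℕ} (ht : Function.Injective t) {S : Set ℕ}
    (hS : Sᶜ.Infinite) (htS : (t '' S)ᶜ.Infinite) :
    ∃ π : Equiv.Perm ℕ, (∀ i ∈ S, π i = t i) ∧ ∀ i ∉ S, π i ∉ t '' S := by
  classical
  have := hS.to_subtype
  have := htS.to_subtype
  obtain ⟨f⟩ := nonempty_equiv_of_countable (α := (Sᶜ : Set ℕ)) (β := ((t '' S)ᶜ : Set ℕ))
  let π : Equiv.Perm ℕ := (Equiv.Set.sumCompl S).symm.trans
    ((Equiv.sumCongr (Equiv.Set.image t S ht) f).trans (Equiv.Set.sumCompl (t '' S)))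
  refine ⟨π, fun i hi => ?_, fun i hi => ?_⟩
  · simp [π, Equiv.Set.sumCompl_symm_apply_of_mem hi]
  · simp only [π, Equiv.trans_apply, Equiv.Set.sumCompl_symm_apply_of_notMem hi,
      Equiv.sumCongr_apply, Sum.map_inr, Equiv.Set.sumCompl_apply_inr]
    exact (f ⟨i, hi⟩).2

/-- For i > 0 with its Haar function on (0,1) the condition only says π i ≠ 0, so these infinitely
many indices can absorb all unused values. On the rest, t is injective through the second component
of the pairing, exceeds `(e i).1` for i > 0, and takes even values only, which leaves infinitely
many values free. -/
theorem exists_isSuitablePerm (e : ℕ ≃ HaarIndex) : ∃ π : Equiv.Perm ℕ, IsSuitablePerm e π := by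
  let t : ℕ → ℕ := fun i => if i = 0 then 0 else 2 * (Nat.pair (e i).1 i + 1)
  have ht : Function.Injective t := fun i j hij => by
    simp only [t] at hij
    split_ifs at hij with h1 h2 h2
    · rw [h1, h2]
    · have h3 : Nat.pair (e i).1 i = Nat.pair (e j).1 j := by omega
      exact (Nat.pair_eq_pair.1 h3).2
  let S : Set ℕ := {i | i = 0 ∨ (e i).1 ≠ 0}
  have hS : Sᶜ.Infinite := by
    have h1 : (e.symm ''
        (range fun n : ℕ => ((0, ⟨n, ⟨0, by positivity⟩⟩) : HaarIndex))).Infinite :=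
      (infinite_range_of_injective fun n m h => by
        simpa using congrArg (fun k : HaarIndex => k.2.1) h).image e.symm.injective.injOn
    refine (h1.sdiff (finite_singleton 0)).mono ?_
    rintro _ ⟨⟨_, ⟨n, rfl⟩, rfl⟩, h⟩
    simp only [S, mem_compl_iff, mem_ofPred_eq, Equiv.apply_symm_apply]
    simpa using h
  have htS : (t '' S)ᶜ.Infinite := by
    have h1 : (range fun n : ℕ => 2 * n + 1).Infinite :=
      infinite_range_of_injective fun n m h => by simpa using h
    refine h1.mono ?_
    rintro _ ⟨n, rfl⟩ ⟨i, -, hi⟩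
    simp only [t] at hi
    split_ifs at hi
    omega
  obtain ⟨π, hπ, hπ'⟩ := exists_perm_extending ht hS htS
  have h0 : (0 : ℕ) ∈ S := Or.inl rfl
  refine ⟨π, by rw [hπ 0 h0]; simp [t], fun i hi => ?_⟩
  by_cases hiS : i ∈ S
  · rw [hπ i hiS]
    simp only [t, hi.ne', if_false]
    have := Nat.left_le_pair (e i).1 i
    omega
  · have h1 : (e i).1 = 0 := by
      by_contra h; exact hiS (Or.inr h)
    rw [h1]
    refine Nat.pos_of_ne_zero fun h => hπ' i hiS ⟨0, h0, by simp [t, h]⟩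

end Enumerations

/-! ### The blocks and their bases. -/

section Blocks

variable {𝕜 : Type*} [RCLike 𝕜] {e : ℕ ≃ HaarIndex} {π : Equiv.Perm ℕ}

theorem blockSeq_even (i : ℕ) : blockSeq 𝕜 e π (2 * i) = blockX 𝕜 e π i := by
  simp [blockSeq]

theorem blockSeq_odd (i : ℕ) : blockSeq 𝕜 e π (2 * i + 1) = blockY 𝕜 e π i := by
  simp only [blockSeq, show (2 * i + 1) % 2 = 1 by omega, show (2 * i + 1) / 2 = i by omega,
    one_ne_zero, if_false]

theorem nonnegL1_blockX (i : ℕ) : NonnegL1 (blockX 𝕜 e π i) := by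
  filter_upwards [Lp.coeFn_add (bumpL1 𝕜 (π i) (e i)) (haarL1 𝕜 (e i)),
    bumpL1_coeFn (𝕜 := 𝕜) (π i) (e i), haarL1_coeFn (𝕜 := 𝕜) (e i)] with t h1 h2 h3
  refine ⟨bumpFun (π i) (e i) t + haarFun (e i) t, ?_, ?_⟩
  · linarith [neg_abs_le (haarFun (e i) t), abs_haarFun_le_bumpFun (π i) (e i) t]
  · rw [blockX, h1, Pi.add_apply, h2, h3, RCLike.ofReal_add]

theorem nonnegL1_blockY (i : ℕ) : NonnegL1 (blockY 𝕜 e π i) := by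
  filter_upwards [Lp.coeFn_sub (bumpL1 𝕜 (π i) (e i)) (haarL1 𝕜 (e i)),
    bumpL1_coeFn (𝕜 := 𝕜) (π i) (e i), haarL1_coeFn (𝕜 := 𝕜) (e i)] with t h1 h2 h3
  refine ⟨bumpFun (π i) (e i) t - haarFun (e i) t, ?_, ?_⟩
  · linarith [le_abs_self (haarFun (e i) t), abs_haarFun_le_bumpFun (π i) (e i) t]
  · rw [blockY, h1, Pi.sub_apply, h2, h3, RCLike.ofReal_sub]

theorem nonnegL1_blockSeq (k : ℕ) : NonnegL1 (blockSeq 𝕜 e π k) := by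
  rw [blockSeq]
  split_ifs
  · exact nonnegL1_blockX _
  · exact nonnegL1_blockY _

theorem blockSeq_ne_zero (k : ℕ) : blockSeq 𝕜 e π k ≠ 0 := by
  -- The integral over the interval of the bump is 2 or 3, hence nonzero.
  have h1 : unitIntegral 𝕜 (π (k / 2)) (blockSeq 𝕜 e π k)
      = 2 + if (e (k / 2)).1 = π (k / 2) then 1 else 0 := by
    rw [blockSeq]
    split_ifs <;> simp [blockX, blockY, unitIntegral_haarL1, unitIntegral_bumpL1, *]
  intro h
  rw [h, map_zero] at h1
  split_ifs at h1
  · norm_num at h1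
  · norm_num at h1

theorem block_eq_span (i : ℕ) :
    block 𝕜 e π i = Submodule.span 𝕜 {blockSeq 𝕜 e π (2 * i), blockSeq 𝕜 e π (2 * i + 1)} := by
  rw [blockSeq_even, blockSeq_odd, block]
  refine le_antisymm (Submodule.span_le.2 ?_) (Submodule.span_le.2 ?_)
  · rintro x (rfl | rfl)
    · refine Submodule.mem_span_pair.2 ⟨2⁻¹, 2⁻¹, ?_⟩
      rw [blockX, blockY, ← smul_add, add_add_sub_cancel, ← two_smul 𝕜, smul_smul]
      norm_num
    · refine Submodule.mem_span_pair.2 ⟨2⁻¹, -2⁻¹, ?_⟩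
      rw [blockX, blockY, neg_smul, ← sub_eq_add_neg, ← smul_sub, add_sub_sub_cancel,
        ← two_smul 𝕜, smul_smul]
      norm_num
  · rintro x (rfl | rfl)
    · exact Submodule.mem_span_pair.2 ⟨1, 1, by simp [blockX]⟩
    · exact Submodule.mem_span_pair.2 ⟨1, -1, by simp [blockY, sub_eq_add_neg]⟩

theorem blockSpan_eq :
    blockSpan 𝕜 e π = (Submodule.span 𝕜 (range (blockSeq 𝕜 e π))).topologicalClosure := by
  rw [blockSpan]
  congr 1
  refine le_antisymm (iSup_le fun i => ?_) (Submodule.span_le.2 ?_)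
  · rw [block_eq_span]
    refine Submodule.span_mono ?_
    rintro x (rfl | rfl) <;> exact mem_range_self _
  · rintro _ ⟨k, rfl⟩
    refine Submodule.mem_iSup_of_mem (k / 2) ?_
    rw [block_eq_span]
    refine Submodule.subset_span ?_
    rcases Nat.mod_two_eq_zero_or_one k with h | h
    · left; congr 1; omega
    · right; rw [mem_singleton_iff]; congr 1; omega

theorem isClosed_blockSpan : IsClosed (blockSpan 𝕜 e π : Set (L1Pos 𝕜)) :=
  Submodule.isClosed_topologicalClosure _

theorem exists_schauderBasis_blockSpan (he : IsHaarEnum e) :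
    ∃ b : SchauderBasis 𝕜 (blockSpan 𝕜 e π), ∀ k, (b k : L1Pos 𝕜) = blockSeq 𝕜 e π k :=
  exists_schauderBasis_of_norm_sum_le (v := blockSeq 𝕜 e π) (K := 25) blockSeq_ne_zero
    (fun c _ _ h => norm_sum_blockSeq_le π he c h) blockSpan_eq

/-- This is the partial sum inequality for coefficients supported on the two positions of one block.
-/
theorem norm_smul_blockX_le (he : IsHaarEnum e) (i : ℕ) (p q : 𝕜) :
    ‖p • blockX 𝕜 e π i‖ ≤ 25 * ‖p • blockX 𝕜 e π i + q • blockY 𝕜 e π i‖ := by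
  have h := norm_sum_blockSeq_le (𝕜 := 𝕜) π he
    (fun k => if k = 2 * i then p else if k = 2 * i + 1 then q else 0)
    (show 2 * i + 1 ≤ 2 * i + 1 + 1 by omega)
  have h0 : ∑ k ∈ Finset.range (2 * i), (if k = 2 * i then p else if k = 2 * i + 1 then q else 0)
      • blockSeq 𝕜 e π k = 0 := Finset.sum_eq_zero fun k hk => by
    have := Finset.mem_range.1 hk
    rw [if_neg (by omega), if_neg (by omega), zero_smul]
  rwa [Finset.sum_range_succ _ (2 * i + 1), Finset.sum_range_succ _ (2 * i), h0, blockSeq_even,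
    blockSeq_odd, zero_add, if_pos rfl, if_neg (Nat.succ_ne_self _), if_pos rfl] at h

theorem isTwoTermBasis_block (he : IsHaarEnum e) (i : ℕ) :
    IsTwoTermBasis (block 𝕜 e π i) (blockX 𝕜 e π i) (blockY 𝕜 e π i) 25 := by
  refine ⟨?_, ?_, by norm_num, norm_smul_blockX_le he i⟩
  · refine LinearIndependent.pair_iff.2 fun p q h => ?_
    have h1 := norm_smul_blockX_le (π := π) he i p q
    rw [h, norm_zero, mul_zero, norm_le_zero_iff] at h1
    rw [h1, zero_add] at h
    rw [← blockSeq_even] at h1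
    rw [← blockSeq_odd] at h
    exact ⟨(smul_eq_zero.1 h1).resolve_right (blockSeq_ne_zero _),
      (smul_eq_zero.1 h).resolve_right (blockSeq_ne_zero _)⟩
  · rw [block_eq_span, blockSeq_even, blockSeq_odd]

theorem finrank_block (he : IsHaarEnum e) (i : ℕ) : Module.finrank 𝕜 (block 𝕜 e π i) = 2 := by
  have h := isTwoTermBasis_block (𝕜 := 𝕜) (π := π) he i
  have h1 := finrank_span_eq_card h.linearIndependent
  rwa [Matrix.range_cons, Matrix.range_cons, Matrix.range_empty, union_empty, singleton_union,
    h.span_eq, Fintype.card_fin] at h1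

theorem isFDD_block (he : IsHaarEnum e) : IsFDD (block 𝕜 e π) (blockSpan 𝕜 e π) := by
  obtain ⟨b, hb⟩ := exists_schauderBasis_blockSpan (𝕜 := 𝕜) (π := π) he
  exact isFDD_of_schauderBasis isClosed_blockSpan b hb block_eq_span

theorem blockSpan_eq_top (he : StartsAtFirst e) (hπ : IsSuitablePerm e π) :
    blockSpan 𝕜 e π = ⊤ := by
  have hle : ∀ i, block 𝕜 e π i ≤ blockSpan 𝕜 e π := fun i =>
    (le_iSup (block 𝕜 e π) i).trans (Submodule.le_topologicalClosure _)
  exact eq_top_of_bumpL1_mem he hπ isClosed_blockSpan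
    (fun i => hle i (Submodule.subset_span (by simp)))
    (fun i => hle i (Submodule.subset_span (by simp)))

theorem exists_schauderBasis_L1Pos (he : IsHaarEnum e) (he' : StartsAtFirst e)
    (hπ : IsSuitablePerm e π) :
    ∃ b : SchauderBasis 𝕜 (L1Pos 𝕜), ∀ k, b k = blockSeq 𝕜 e π k := by
  obtain ⟨b, hb⟩ := exists_schauderBasis_blockSpan (𝕜 := 𝕜) (π := π) he
  refine ⟨mapSchauderBasis b
    (LinearIsometryEquiv.ofTop _ _ (blockSpan_eq_top he' hπ)).toContinuousLinearEquiv, fun k => ?_⟩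
  rw [← hb]
  rfl

end Blocks

theorem theorem1 (𝕜 : Type*) [RCLike 𝕜] :
    -- `L₁(0, ∞)` has a Schauder basis of non-negative functions
    (∃ b : SchauderBasis 𝕜 (L1Pos 𝕜), ∀ i, NonnegL1 (b i)) ∧
    -- so does every separable `L₁(μ)`
    (∀ (α : Type*) [MeasurableSpace α] (μ : Measure α),
      TopologicalSpace.SeparableSpace (Lp 𝕜 1 μ) → HasNonnegSchauderBasis 𝕜 μ) ∧
    -- for every admissible enumeration and every permutation the two dimensional blocks form an
    -- FDD of their closed span, and have non-negative two term bases with a uniform constant,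
    -- which together form a Schauder basis of that closed span
    (∃ C : ℝ, ∀ (e : ℕ ≃ HaarIndex) (π : Equiv.Perm ℕ), IsHaarEnum e →
      (∀ i, Module.finrank 𝕜 (block 𝕜 e π i) = 2) ∧
      IsFDD (block 𝕜 e π) (blockSpan 𝕜 e π) ∧
      (∀ i, NonnegL1 (blockX 𝕜 e π i) ∧ NonnegL1 (blockY 𝕜 e π i) ∧
        IsTwoTermBasis (block 𝕜 e π i) (blockX 𝕜 e π i) (blockY 𝕜 e π i) C) ∧
      (∃ b : SchauderBasis 𝕜 (blockSpan 𝕜 e π),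
        ∀ k, (b k : L1Pos 𝕜) = blockSeq 𝕜 e π k)) ∧
    -- suitable enumerations and permutations exist, and for all of these the construction
    -- yields a basis of the whole space
    (∃ e : ℕ ≃ HaarIndex, IsHaarEnum e ∧ StartsAtFirst e) ∧
    (∀ e : ℕ ≃ HaarIndex, IsHaarEnum e → StartsAtFirst e →
      (∃ π : Equiv.Perm ℕ, IsSuitablePerm e π) ∧
      (∀ π : Equiv.Perm ℕ, IsSuitablePerm e π →
        blockSpan 𝕜 e π = ⊤ ∧
        IsFDD (block 𝕜 e π) ⊤ ∧
        ∃ b : SchauderBasis 𝕜 (L1Pos 𝕜), ∀ k, b k = blockSeq 𝕜 e π k)) := by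
  obtain ⟨e₀, he₀, he₀'⟩ := exists_isHaarEnum
  obtain ⟨π₀, hπ₀⟩ := exists_isSuitablePerm e₀
  obtain ⟨b₀, hb₀⟩ := exists_schauderBasis_L1Pos (𝕜 := 𝕜) he₀ he₀' hπ₀
  have hb₀' : ∀ i, NonnegL1 (b₀ i) := fun i => by rw [hb₀]; exact nonnegL1_blockSeq i
  refine ⟨⟨b₀, hb₀'⟩, fun α _ μ _ => hasNonnegSchauderBasis_of_separable 𝕜 μ b₀ hb₀',
    ⟨25, fun e π he => ⟨finrank_block he, isFDD_block he, fun i =>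
      ⟨nonnegL1_blockX i, nonnegL1_blockY i, isTwoTermBasis_block he i⟩,
      exists_schauderBasis_blockSpan he⟩⟩, ⟨e₀, he₀, he₀'⟩, fun e he he' =>
    ⟨exists_isSuitablePerm e, fun π hπ => ⟨blockSpan_eq_top he' hπ, ?_,
      exists_schauderBasis_L1Pos he he' hπ⟩⟩⟩
  rw [← blockSpan_eq_top (𝕜 := 𝕜) he' hπ]
  exact isFDD_block he
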